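/- **Model.** Small base stations (SBSs) form a homogeneous Poisson point process of density $\lambda_S>0$ in the plane. Each SBS carries independent marks, independent of the positions: a channel power gain $h_i\sim\exp(1)$ towards the typical user at the origin; a requested content from a library $\{1,\dots,J\}$, drawn with Zipf probabilities $a_j=j^{-\varsigma}/\sum_{m=1}^J m^{-\varsigma}$; and, independently of the request, a random cache of at most $L$ contents that contains content $j$ with probability $q_j$. Put $q_{\rm hit}=\sum_{j=1}^J a_jq_j$ and assume $q_{\rm hit}>0$. The typical user is served by the nearest SBS $o$, at distance $|X_o|$; $\Phi_S^a$ is the set of SBSs whose requested content is in their own cache. The load $K$ of the serving cell is one plus the number of other users in it. As usual, the cell area is modelled by a gamma law: $\lambda_S$ times the area of the serving cell has the size-biased version of the gamma law with shape and rate $\gamma=3.5$; given the area $A$, the number of other users is Poisson with mean $\lambda_U A$, where $\lambda_U>0$; and $K$ is independent of positions and marks. Noise is neglected, so with path loss $L(d)=\beta d^{-\alpha_a}$, $\alpha_a>2$, $\beta>0$, transmit power $P_a>0$, bandwidth $W>0$ and access fraction $0<\eta\le1$ the rate is $$R_a=\frac{\eta W}{K}\log_2\Bigl(1+\frac{P_ah_oL(|X_o|)}{\sum_{i\in\Phi_S^a\setminus\{o\}}P_ah_iL(|X_{o,i}|)}\Bigr).$$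 For $Q,T_{\rm th}>0$ let $\Lambda(k)$ be the conditional probability of $R_a\ge Q/T_{\rm th}$ given that the requested content is cached at the serving SBS and that $K=k$. Fix a threshold $0<\epsilon\le 1$. Successful content delivery (SCD) takes place when the load $K$ is such that $\Lambda(K)\ge\epsilon$, and $\Psi^a_{\rm SCD}(Q,T_{\rm th})$ is the probability of this, given that the requested content is cached at the serving SBS. **Theorem 1.** For every integer $k\ge1$, $$\Pr(K=k)=\mathcal P_{\lambda_U/\lambda_S}(k):=\frac{\gamma^\gamma}{(k-1)!}\,\frac{\Gamma(k+\gamma)}{\Gamma(\gamma)}\,\frac{(\lambda_U/\lambda_S)^{k-1}}{(\gamma+\lambda_U/\lambda_S)^{k+\gamma}},\qquad\gamma=3.5.$$ The equation $$\frac{2^{\frac{\kappa Q}{\eta WT_{\rm th}}+1}-2}{\alpha_a-2}\;{}_2F_1\Bigl[1,1-\tfrac2{\alpha_a};2-\tfrac2{\alpha_a};1-2^{\frac{\kappa Q}{\eta WT_{\rm th}}}\Bigr]=\frac{1-\epsilon}{q_{\rm hit}\,\epsilon}$$ (where ${}_2F_1$ is the Gauss hypergeometric function, continued analytically to $(-\infty,1)$)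 has exactly one real solution $\kappa$, and $\kappa\ge0$. Its integer part $K_{\max}^a=\lfloor\kappa\rfloor$ is the maximum load: for every integer $k\ge1$, $\Lambda(k)\ge\epsilon$ if and only if $k\le K^a_{\max}$. The SCD probability is $$\Psi^a_{\rm SCD}(Q,T_{\rm th})=\sum_{k=1}^{K_{\max}^a}\mathcal P_{\lambda_U/\lambda_S}(k).$$ The bisection search for $\kappa$ (replace the lower or the upper end of the bracket by its midpoint when the left-hand side there is smaller or larger than the right-hand side, and both ends when it is equal), started from any bracket $[k^l,k^h]$ containing $\kappa$, keeps $\kappa$ in the bracket, whose length after $n$ steps is at most $2^{-n}(k^h-k^l)$. -/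

import Mathlib

open MeasureTheory ProbabilityTheory Set
open scoped ENNReal NNReal Nat

noncomputable section

namespace EdgeCaching

/-! ### Gauss hypergeometric function -/

/-- `F` is the real-analytic continuation to `(-∞, 1)` of the Gauss hypergeometric series
`∑ (a)ₙ (b)ₙ / (c)ₙ · zⁿ / n!`, which itself converges only for `|z| < 1`. -/
def IsGaussContinuation (a b c : ℝ) (F : ℝ → ℝ) : Prop :=
  AnalyticOnNhd ℝ F (Iio 1) ∧ ∀ z : ℝ, |z| < 1 → F z = ordinaryHypergeometric a b c z

theorem IsGaussContinuation.unique {a b c : ℝ} {F G : ℝ → ℝ}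
    (hF : IsGaussContinuation a b c F) (hG : IsGaussContinuation a b c G) :
    EqOn F G (Iio 1) := by
  refine hF.1.eqOn_of_preconnected_of_eventuallyEq hG.1 isPreconnected_Iio
    (z₀ := 0) (by simp) ?_
  filter_upwards [Metric.ball_mem_nhds (0 : ℝ) one_pos] with z hz
  have hz' : |z| < 1 := by simpa using hz
  rw [hF.2 z hz', hG.2 z hz']

open Classical in
/-- The Gauss hypergeometric function `₂F₁[a, b; c; z]` for real parameters and real `z < 1`:
the sum of the Gauss series continued analytically to `(-∞, 1)`. -/
def gaussHyp (a b c z : ℝ) : ℝ :=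
  if h : ∃ F, IsGaussContinuation a b c F then h.choose z else 0

theorem gaussHyp_eq {a b c : ℝ} {F : ℝ → ℝ} (hF : IsGaussContinuation a b c F) {z : ℝ}
    (hz : z < 1) : gaussHyp a b c z = F z := by
  have h : ∃ F, IsGaussContinuation a b c F := ⟨F, hF⟩
  rw [gaussHyp, dif_pos h]
  exact h.choose_spec.unique hF hz

/-! ### Poisson point processes in the plane -/

/-- The Euclidean plane; the typical user sits at the origin. -/
abbrev Plane := EuclideanSpace ℝ (Fin 2)

/-- Number of points of the sequence `x` that lie in `B`. -/
def pointCount (x : ℕ → Plane) (B : Set Plane) : ℕ∞ := {i | x i ∈ B}.encard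

/-- The random points `x 0, x 1, …` enumerate a homogeneous Poisson point process of
density `lam`: the number of points in a bounded Borel set is Poisson with mean
`lam * area`, and the numbers of points in disjoint bounded Borel sets are independent. -/
structure IsHPPP {Ω : Type*} [MeasurableSpace Ω] (μ : Measure Ω)
    (x : ℕ → Ω → Plane) (lam : ℝ) : Prop where
  measurable : ∀ i, Measurable (x i)
  count_law : ∀ B : Set Plane, MeasurableSet B → Bornology.IsBounded B → ∀ k : ℕ,
    μ {ω | pointCount (fun i => x i ω) B = (k : ℕ∞)} =
      poissonMeasure (Real.toNNReal (lam * volume.real B)) {k}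
  count_indep : ∀ (n : ℕ) (B : Fin n → Set Plane), (∀ j, MeasurableSet (B j)) →
    (∀ j, Bornology.IsBounded (B j)) → Pairwise (fun j l => Disjoint (B j) (B l)) →
    iIndepFun (fun j ω => pointCount (fun i => x i ω) (B j)) μ

/-! ### Content popularity and caching -/

/-- Zipf request probability of the content of popularity rank `j + 1` among `J` contents. -/
def zipf (J : ℕ) (s : ℝ) (j : Fin J) : ℝ :=
  ((j : ℝ) + 1) ^ (-s) / ∑ m : Fin J, ((m : ℝ) + 1) ^ (-s)

/-- Hit probability `∑ⱼ aⱼ qⱼ`. -/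
def hitProb {J : ℕ} (s : ℝ) (q : Fin J → ℝ) : ℝ := ∑ j, zipf J s j * q j

/-! ### The law of the cell area -/

/-- Shape parameter `3.5` of the gamma law of normalized Poisson–Voronoi cell areas. -/
def gam : ℝ := 3.5

/-- Law of the normalized area of the cell that contains the typical user: the size-biased
version of the gamma law (shape `γ`, mean one) of normalized cell areas. -/
def taggedAreaLaw : Measure ℝ :=
  (gammaMeasure gam gam).withDensity fun x => ENNReal.ofReal x

/-- The load probability mass function
`P_ρ(k) = γ^γ / (k-1)! · Γ(k+γ)/Γ(γ) · ρ^(k-1) / (γ+ρ)^(k+γ)`, for `k ≥ 1`. -/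
def loadPMF (ρ : ℝ) (k : ℕ) : ℝ :=
  gam ^ gam / ((k - 1)! : ℝ) * (Real.Gamma (k + gam) / Real.Gamma gam) *
    (ρ ^ (k - 1) / (gam + ρ) ^ ((k : ℝ) + gam))

/-! ### The network -/

/-- The random elements of the small-cell network, for a library of `J` contents. -/
structure Network (Ω : Type*) (J : ℕ) where
  /-- positions of the small-cell base stations (SBSs) -/
  pos : ℕ → Ω → Plane
  /-- channel power gains between the SBSs and the typical user -/
  fading : ℕ → Ω → ℝ
  /-- the content currently requested from each SBS -/
  request : ℕ → Ω → Fin J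
  /-- the set of contents cached at each SBS -/
  cache : ℕ → Ω → Set (Fin J)
  /-- area of the cell that contains the typical user -/
  cellArea : Ω → ℝ
  /-- number of the other users in that cell -/
  others : Ω → ℕ

/-- The stochastic model. -/
structure Network.IsModel {Ω : Type*} [MeasurableSpace Ω] {J : ℕ} (N : Network Ω J)
    (μ : Measure Ω) (lamU lamS s : ℝ) (L : ℕ) (q : Fin J → ℝ) : Prop where
  /-- the SBSs form a homogeneous Poisson point process of density `lamS` -/
  pos_hppp : IsHPPP μ N.pos lamS
  fading_meas : ∀ i, Measurable (N.fading i)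
  /-- Rayleigh fading -/
  fading_law : ∀ i, μ.map (N.fading i) = expMeasure 1
  request_meas : ∀ i, Measurable (N.request i)
  request_law : ∀ i j, μ {ω | N.request i ω = j} = ENNReal.ofReal (zipf J s j)
  cache_meas : ∀ i, Measurable (N.cache i)
  /-- probabilistic caching: content `j` is cached with probability `q j` -/
  cache_law : ∀ i j, μ {ω | j ∈ N.cache i ω} = ENNReal.ofReal (q j)
  /-- an SBS caches at most `L` contents -/
  cache_size : ∀ i, ∀ᵐ ω ∂μ, (N.cache i ω).ncard ≤ L
  /-- at a given SBS, fading, request and cache are independent -/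
  request_cache_indep : ∀ i, IndepFun (N.request i) (N.cache i) μ
  fading_indep : ∀ i, IndepFun (N.fading i) (fun ω => (N.request i ω, N.cache i ω)) μ
  /-- different SBSs have independent marks -/
  marks_indep : iIndepFun (fun i ω => (N.fading i ω, N.request i ω, N.cache i ω)) μ
  /-- the marks are independent of the positions -/
  pos_marks_indep : IndepFun (fun ω i => N.pos i ω)
    (fun ω i => (N.fading i ω, N.request i ω, N.cache i ω)) μ
  area_meas : Measurable N.cellArea
  others_meas : Measurable N.others
  /-- the area, divided by the mean cell area `1 / lamS`, has the tagged-cell law -/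
  area_law : μ.map (fun ω => lamS * N.cellArea ω) = taggedAreaLaw
  /-- users form a Poisson process of density `lamU`: given that the area is `A`, the number
  of the other users in the cell is Poisson with mean `lamU * A` -/
  others_law : ∀ B : Set ℝ, MeasurableSet B → ∀ n : ℕ,
    μ {ω | N.cellArea ω ∈ B ∧ N.others ω = n} =
      ∫⁻ ω in N.cellArea ⁻¹' B, poissonMeasure (Real.toNNReal (lamU * N.cellArea ω)) {n} ∂μ
  /-- the cell load is independent of positions and marks -/
  load_indep : IndepFun (fun ω => (N.cellArea ω, N.others ω))
    (fun ω i => (N.pos i ω, N.fading i ω, N.request i ω, N.cache i ω)) μ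

/-- Physical parameters of the access links. -/
structure Access where
  /-- fraction of the bandwidth that is allocated to access -/
  η : ℝ
  /-- system bandwidth -/
  W : ℝ
  /-- transmit power of an SBS -/
  P : ℝ
  /-- frequency dependent constant of the path loss -/
  β : ℝ
  /-- path loss exponent -/
  α : ℝ
  /-- noise power -/
  noise : ℝ

/-- Path loss `L(d) = β d^{-α}`. -/
def Access.pathLoss (A : Access) (d : ℝ) : ℝ := A.β * d ^ (-A.α)

variable {Ω : Type*} {J : ℕ}

/-- Index of the SBS nearest to the origin, which serves the typical user (equal transmit
powers, so it is the one with maximum average received power). -/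
def Network.server (N : Network Ω J) (ω : Ω) : ℕ :=
  sInf {n | ∀ i, ‖N.pos n ω‖ ≤ ‖N.pos i ω‖}

/-- SBS `i` has cached the content that is requested from it. -/
def Network.Hit (N : Network Ω J) (i : ℕ) (ω : Ω) : Prop := N.request i ω ∈ N.cache i ω

/-- The requested content is stored at the serving SBS. -/
def Network.cached (N : Network Ω J) : Set Ω := {ω | N.Hit (N.server ω) ω}

/-- Cell load: the typical user and the other users of its cell. -/
def Network.load (N : Network Ω J) (ω : Ω) : ℕ := N.others ω + 1

open Classical in
/-- Interference at the origin from all SBSs, except the serving one, that are delivering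
cached contents. All terms are nonnegative. -/
def Network.interference (N : Network Ω J) (A : Access) (ω : Ω) : ℝ :=
  ∑' i, if i ≠ N.server ω ∧ N.Hit i ω then
    A.P * N.fading i ω * A.pathLoss ‖N.pos i ω‖ else 0

/-- Rate of the typical access link. -/
def Network.rate (N : Network Ω J) (A : Access) (ω : Ω) : ℝ :=
  A.η * A.W / N.load ω * Real.logb 2 (1 +
    A.P * N.fading (N.server ω) ω * A.pathLoss ‖N.pos (N.server ω) ω‖ /
      (N.interference A ω + A.noise))

variable [MeasurableSpace Ω]

/-- Conditional probability, given that the content is cached at the serving SBS and that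
the cell load is `k`, that the rate is at least `Q / T`, i.e. that `Q` bits are delivered
within time `T`. -/
def Network.condSuccess (N : Network Ω J) (μ : Measure Ω) (A : Access) (Q T : ℝ) (k : ℕ) : ℝ :=
  (μ[|N.cached ∩ {ω | N.load ω = k}]).real {ω | Q / T ≤ N.rate A ω}

/-- Successful content delivery probability of a cached content: the probability, given that
the content is cached at the serving SBS, that the cell load is one at which the rate
requirement is met with probability at least `ε`. -/
def Network.scdProb (N : Network Ω J) (μ : Measure Ω) (A : Access) (Q T ε : ℝ) : ℝ :=
  (μ[|N.cached]).real {ω | ε ≤ N.condSuccess μ A Q T (N.load ω)}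

/-! ### The equation for the maximum load, and the search for its solution -/

/-- Left-hand side of the equation for the maximum load, as a function of a real load `t`. -/
def loadFun (A : Access) (Q T t : ℝ) : ℝ :=
  ((2 : ℝ) ^ (t * Q / (A.η * A.W * T) + 1) - 2) / (A.α - 2) *
    gaussHyp 1 (1 - 2 / A.α) (2 - 2 / A.α) (1 - (2 : ℝ) ^ (t * Q / (A.η * A.W * T)))

/-- One step of the one-dimensional search for the solution of `F = c` in a bracket
`(kl, kh)`: replace an end by the midpoint, or stop if the midpoint is the solution. -/
def searchStep (F : ℝ → ℝ) (c : ℝ) (p : ℝ × ℝ) : ℝ × ℝ :=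
  if F ((p.1 + p.2) / 2) = c then ((p.1 + p.2) / 2, (p.1 + p.2) / 2)
  else if F ((p.1 + p.2) / 2) < c then ((p.1 + p.2) / 2, p.2)
  else (p.1, (p.1 + p.2) / 2)

end EdgeCaching

end

open Filter Topology

/-! ### The Gauss hypergeometric function as an integral -/

section CauchyTransform

variable {X : Type*} [MeasurableSpace X] {m : Measure X} {u : X → ℝ}

/-! Write `p` for the hit probability, `δ = α / 2`, `θ = 2 ^ (k Q / (η W T)) - 1`, let `tᵢ` be the
squared distance of SBS `i` times `π λ_S`, and let `vᵢ` be its gain `hᵢ` if it has a hit and `0`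
otherwise. The `tᵢ` form a unit-rate Poisson process on the half-line, and the server `o` has the
smallest one. Almost surely, a hit at the server together with a sufficient rate at load `k` means
`I ≤ vₒ`, where `I = θ ∑_{i ≠ o} (tₒ / tᵢ) ^ δ vᵢ`.

Fix the positions. Then `vₒ` is independent of `I` and has tail `p e^{-y}` for `y > 0`, so the event
has probability `p E e^{-I}`, provided `I = 0` is null. The independent marks turn `E e^{-I}` into
the product of `f (tₒ / tᵢ)` over `i ≠ o`, with `f x = 1 - p θ x ^ δ / (1 + θ x ^ δ)`. Now average
over the positions: given `tₒ = t`, the other points form a Poisson process on `(t, ∞)`, and the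
mean product is `exp (-t p G(θ))` with `G(θ) = ∫_{v > 1} θ / (v ^ δ + θ) dv`. As `tₒ` is unit
exponential, the result is `1 / (1 + p G(θ))` (`lintegral_expNeg_scaledInterf`). Division by `P(hit)
= p`, and independence of the load, give the conditional success probability `1 / (1 + p G(θ))`
(`Network.IsModel.condSuccess_eq`).

The average over positions uses nothing but the counts in bounded sets. The half-line is cut into
cells of length `Δ`; on the event that the first occupied cell holds a single point, the product is
squeezed between products over cells, whose means follow from independence of the counts. Summing
geometric series and letting `Δ → 0` gives the value (`IsUnitPoisson.lintegral_ratioProd`).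

Expanding `G` in powers of `θ` identifies it with the hypergeometric left-hand side of the equation
(`loadFun_eq_interfExponent`). As an integral it is visibly continuous, strictly increasing, zero at
`θ = 0` and unbounded. Hence `κ` exists and is unique, `ε ≤ Λ(k)` amounts to `k ≤ κ`, and bisection
works. The load law is a Poisson law mixed over a size-biased gamma law, a single gamma integral. -/

theorem norm_one_sub_mul_ge {z : ℂ} {ε t : ℝ} (hε : ε ≤ 1) (hz : z.re ≤ 1 - ε)
    (ht0 : 0 ≤ t) (ht1 : t ≤ 1) : ε ≤ ‖1 - z * t‖ := by
  have h1 : (1 - z * t).re = 1 - z.re * t := by simp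
  have h2 := (le_abs_self _).trans (Complex.abs_re_le_norm (1 - z * t))
  rw [h1] at h2
  refine le_trans ?_ h2
  nlinarith

theorem differentiableAt_integral_div_one_sub_mul (hu : Integrable u m)
    (hu0 : ∀ᵐ x ∂m, 0 ≤ u x) (hu1 : ∀ᵐ x ∂m, u x ≤ 1) {z₀ : ℂ} (hz₀ : z₀.re < 1) :
    DifferentiableAt ℂ (fun z : ℂ => ∫ x, (u x : ℂ) / (1 - z * u x) ∂m) z₀ := by
  -- Half the distance from `z₀` to the line `Re z = 1`, capped at `1` because the lower bound on
  -- `‖1 - z u‖` needs `ε ≤ 1`.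
  obtain ⟨ε, hε0, hε1, hε⟩ : ∃ ε : ℝ, 0 < ε ∧ ε ≤ 1 ∧ z₀.re < 1 - ε := by
    refine ⟨min 1 ((1 - z₀.re) / 2), ?_, min_le_left _ _, ?_⟩
    · apply lt_min one_pos; linarith
    · have := min_le_right 1 ((1 - z₀.re) / 2); linarith
  have hs : {z : ℂ | z.re < 1 - ε} ∈ 𝓝 z₀ :=
    (isOpen_lt Complex.continuous_re continuous_const).mem_nhds hε
  have hum : AEStronglyMeasurable (fun x => (u x : ℂ)) m :=
    Complex.continuous_ofReal.comp_aestronglyMeasurable hu.1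
  have hmeas : ∀ z : ℂ, AEStronglyMeasurable (fun x => (u x : ℂ) / (1 - z * u x)) m := by
    intro z
    have := hum.aemeasurable
    exact AEMeasurable.aestronglyMeasurable (by fun_prop)
  have key := hasDerivAt_integral_of_dominated_loc_of_deriv_le (μ := m) (𝕜 := ℂ)
    (F := fun (z : ℂ) x => (u x : ℂ) / (1 - z * u x))
    (F' := fun (z : ℂ) x => (u x : ℂ) ^ 2 / (1 - z * u x) ^ 2) (x₀ := z₀)
    (bound := fun x => u x / ε ^ 2) hs (Eventually.of_forall hmeas) ?_ ?_ ?_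
    (hu.div_const _) ?_
  · exact key.2.differentiableAt
  · refine (hu.div_const ε).mono' (hmeas z₀) ?_
    filter_upwards [hu0, hu1] with x h0 h1
    rw [norm_div, Complex.norm_real, Real.norm_of_nonneg h0]
    exact div_le_div_of_nonneg_left h0 hε0 (norm_one_sub_mul_ge hε1 hε.le h0 h1)
  · have := hum.aemeasurable
    exact AEMeasurable.aestronglyMeasurable (by fun_prop)
  · filter_upwards [hu0, hu1] with x h0 h1 z hz
    rw [norm_div, norm_pow, norm_pow, Complex.norm_real, Real.norm_of_nonneg h0]
    have h3 := norm_one_sub_mul_ge hε1 (le_of_lt hz) h0 h1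
    -- The derivative carries `u ^ 2`, which is dominated by the integrable `u` because `0 ≤ u ≤ 1`.
    have : u x ^ 2 ≤ u x := by nlinarith
    gcongr
  · filter_upwards [hu0, hu1] with x h0 h1 z hz
    have h3 := norm_one_sub_mul_ge hε1 (le_of_lt hz) h0 h1
    have hne : (1 - z * u x : ℂ) ≠ 0 := norm_pos_iff.1 (hε0.trans_le h3)
    have hd : HasDerivAt (fun z : ℂ => 1 - z * (u x : ℂ)) (-(u x : ℂ)) z := by
      simpa using ((hasDerivAt_id z).mul_const (u x : ℂ)).const_sub 1
    refine ((hasDerivAt_const z (u x : ℂ)).div hd hne).congr_deriv ?_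
    ring

/-- The real integral is the restriction of one that is holomorphic on `Re z < 1`; complex
differentiability gives analyticity for free. This reaches all of `(-∞, 1)`, beyond the disc of the
power series. -/
theorem analyticOnNhd_integral_div_one_sub_mul (hu : Integrable u m)
    (hu0 : ∀ᵐ x ∂m, 0 ≤ u x) (hu1 : ∀ᵐ x ∂m, u x ≤ 1) :
    AnalyticOnNhd ℝ (fun z : ℝ => ∫ x, u x / (1 - z * u x) ∂m) (Iio 1) := by
  have hopen : IsOpen {z : ℂ | z.re < 1} := isOpen_lt Complex.continuous_re continuous_const
  have hC : AnalyticOnNhd ℂ (fun z : ℂ => ∫ x, (u x : ℂ) / (1 - z * u x) ∂m)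
      {z : ℂ | z.re < 1} :=
    DifferentiableOn.analyticOnNhd (fun z hz =>
      (differentiableAt_integral_div_one_sub_mul hu hu0 hu1 hz).differentiableWithinAt) hopen
  intro z hz
  have h1 : AnalyticAt ℝ (fun z : ℂ => ∫ x, (u x : ℂ) / (1 - z * u x) ∂m) (z : ℂ) :=
    (hC (z : ℂ) (by simpa using hz)).restrictScalars
  have h2 : AnalyticAt ℝ (fun z : ℝ => (z : ℂ)) z := Complex.ofRealCLM.analyticAt z
  have h3 := (Complex.reCLM.analyticAt _).comp (h1.comp h2)
  refine h3.congr (Eventually.of_forall fun y => ?_)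
  simp only [Function.comp_apply, Complex.reCLM_apply]
  rw [← Complex.ofReal_re (∫ x, u x / (1 - y * u x) ∂m), ← integral_complex_ofReal]
  simp

/-- Geometric expansion of the integrand; the norms are summable because the moments of `u` are all
bounded by the first one. -/
theorem hasSum_integral_div_one_sub_mul (hu : Integrable u m)
    (hu0 : ∀ᵐ x ∂m, 0 ≤ u x) (hu1 : ∀ᵐ x ∂m, u x ≤ 1) {z : ℝ} (hz : |z| < 1) :
    HasSum (fun n : ℕ => z ^ n * ∫ x, u x ^ (n + 1) ∂m) (∫ x, u x / (1 - z * u x) ∂m) := by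
  have hpow : ∀ n : ℕ, Integrable (fun x => u x ^ (n + 1)) m := by
    intro n
    refine hu.mono' (hu.1.pow _) ?_
    filter_upwards [hu0, hu1] with x h0 h1
    rw [norm_pow, Real.norm_of_nonneg h0]
    exact pow_le_of_le_one h0 h1 (by omega)
  have hle : ∀ n : ℕ, ∫ x, u x ^ (n + 1) ∂m ≤ ∫ x, u x ∂m := by
    intro n
    refine integral_mono_ae (hpow n) hu ?_
    filter_upwards [hu0, hu1] with x h0 h1
    exact pow_le_of_le_one h0 h1 (by omega)
  have hnn : ∀ n : ℕ, 0 ≤ ∫ x, u x ^ (n + 1) ∂m := fun n =>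
    integral_nonneg_of_ae (by filter_upwards [hu0] with x h0 using pow_nonneg h0 _)
  have hnorm : ∀ n : ℕ, ∫ x, ‖z ^ n * u x ^ (n + 1)‖ ∂m = |z| ^ n * ∫ x, u x ^ (n + 1) ∂m := by
    intro n
    rw [← integral_const_mul]
    refine integral_congr_ae ?_
    filter_upwards [hu0] with x h0
    rw [norm_mul, norm_pow, norm_pow, Real.norm_eq_abs, Real.norm_of_nonneg h0]
  have key := hasSum_integral_of_summable_integral_norm (μ := m)
    (F := fun (n : ℕ) x => z ^ n * u x ^ (n + 1)) (fun n => (hpow n).const_mul _) ?_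
  · simp_rw [integral_const_mul] at key
    convert! key using 1
    · refine integral_congr_ae ?_
      filter_upwards [hu0, hu1] with x h0 h1
      have hlt : |z * u x| < 1 := by
        rw [abs_mul, abs_of_nonneg h0]
        nlinarith [abs_nonneg z]
      have hg := (hasSum_geometric_of_abs_lt_one hlt).mul_left (u x)
      rw [div_eq_mul_inv, ← hg.tsum_eq]
      refine tsum_congr fun n => ?_
      rw [mul_pow]; ring
  · simp_rw [hnorm]
    refine Summable.of_nonneg_of_le (fun n => mul_nonneg (pow_nonneg (abs_nonneg z) _) (hnn n))
      (fun n => mul_le_mul_of_nonneg_left (hle n) (pow_nonneg (abs_nonneg z) _))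
      ((summable_geometric_of_lt_one (abs_nonneg z) hz).mul_right _)

end CauchyTransform

theorem ascPochhammer_eval_mul_add (b : ℝ) (n : ℕ) :
    (ascPochhammer ℝ n).eval b * (b + n) = b * (ascPochhammer ℝ n).eval (b + 1) := by
  induction n with
  | zero => simp
  | succ n ih =>
    rw [ascPochhammer_succ_eval, ascPochhammer_succ_eval, ih]
    push_cast; ring

/-- `(1)ₙ` cancels `n!`, and `(b)ₙ / (b + 1)ₙ` telescopes. -/
theorem ordinaryHypergeometric_one_left {b z : ℝ} (hb : 0 < b) :
    ordinaryHypergeometric 1 b (b + 1) z = ∑' n : ℕ, b / (b + n) * z ^ n := by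
  rw [ordinaryHypergeometric_eq_tsum]
  refine tsum_congr fun n => ?_
  have h1 : 0 < (ascPochhammer ℝ n).eval (b + 1) := ascPochhammer_pos n _ (by linarith)
  have h2 : (0 : ℝ) < b + n := by positivity
  have h3 := ascPochhammer_eval_mul_add b n
  have h4 : ((n ! : ℕ) : ℝ) ≠ 0 := by positivity
  rw [ascPochhammer_eval_one, smul_eq_mul]
  congr 1
  field_simp
  linarith

namespace EdgeCaching

/-- The scaled mean interference per unit distance: `∫_{v > 1} θ / (v ^ δ + θ) dv`. -/
noncomputable def interfExponent (δ θ : ℝ) : ℝ := ∫ v in Ioi (1 : ℝ), θ / (v ^ δ + θ)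

theorem integrableOn_rpow_neg {δ : ℝ} (hδ : 1 < δ) :
    IntegrableOn (fun v : ℝ => v ^ (-δ)) (Ioi 1) :=
  integrableOn_Ioi_rpow_of_lt (by linarith) one_pos

/-- For `u = v ^ (-δ)` on `(1, ∞)` the moments are `1 / (δ (n + 1) - 1)`; times `δ - 1` they are the
coefficients `b / (b + n)` with `b = 1 - 1 / δ`. -/
theorem isGaussContinuation_integral {δ : ℝ} (hδ : 1 < δ) :
    IsGaussContinuation 1 (1 - 1 / δ) (2 - 1 / δ)
      (fun z => (δ - 1) * ∫ v in Ioi (1 : ℝ), v ^ (-δ) / (1 - z * v ^ (-δ))) := by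
  have hu := integrableOn_rpow_neg hδ
  have hu0 : ∀ᵐ v ∂(volume.restrict (Ioi (1 : ℝ))), 0 ≤ v ^ (-δ) := by
    filter_upwards [ae_restrict_mem measurableSet_Ioi] with v hv
    exact Real.rpow_nonneg (zero_le_one.trans (le_of_lt hv)) _
  have hu1 : ∀ᵐ v ∂(volume.restrict (Ioi (1 : ℝ))), v ^ (-δ) ≤ 1 := by
    filter_upwards [ae_restrict_mem measurableSet_Ioi] with v hv
    exact Real.rpow_le_one_of_one_le_of_nonpos (le_of_lt hv) (by linarith)
  have hb : 0 < 1 - 1 / δ := by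
    rw [sub_pos, div_lt_one (by linarith)]; exact hδ
  refine ⟨analyticOnNhd_const.mul (analyticOnNhd_integral_div_one_sub_mul hu hu0 hu1), ?_⟩
  intro z hz
  change (δ - 1) * ∫ v in Ioi (1 : ℝ), v ^ (-δ) / (1 - z * v ^ (-δ)) = _
  rw [show 2 - 1 / δ = (1 - 1 / δ) + 1 by ring, ordinaryHypergeometric_one_left hb,
    ← (hasSum_integral_div_one_sub_mul hu hu0 hu1 hz).tsum_eq, ← tsum_mul_left]
  refine tsum_congr fun n => ?_
  have h1 : ∫ v in Ioi (1 : ℝ), (v ^ (-δ)) ^ (n + 1) = 1 / (δ * (n + 1) - 1) := by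
    rw [setIntegral_congr_fun (g := fun v : ℝ => v ^ (-δ * (n + 1))) measurableSet_Ioi]
    · rw [integral_Ioi_rpow_of_lt _ one_pos]
      · rw [Real.one_rpow, neg_div, ← div_neg]; congr 1; ring
      · nlinarith [(Nat.cast_nonneg n : (0 : ℝ) ≤ n)]
    · intro v hv
      have : (0 : ℝ) ≤ v := zero_le_one.trans (le_of_lt hv)
      simp only
      rw [← Real.rpow_natCast, ← Real.rpow_mul this]
      push_cast; rfl
  rw [h1]
  have h2 : 0 < δ * (n + 1) - 1 := by nlinarith [(Nat.cast_nonneg n : (0 : ℝ) ≤ n)]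
  have h3 : 0 < δ := by linarith
  have h4 : 1 - 1 / δ + n = (δ * (n + 1) - 1) / δ := by field_simp; ring
  rw [h4]
  field_simp

/-- Links the equation for the maximum load to the stochastic model. The range `θ > -1` covers the
thresholds of all real loads, including negative ones, as uniqueness of `κ` on the whole line
requires. -/
theorem interfExponent_eq_gaussHyp {δ θ : ℝ} (hδ : 1 < δ) (hθ : -1 < θ) :
    θ / (δ - 1) * gaussHyp 1 (1 - 1 / δ) (2 - 1 / δ) (-θ) = interfExponent δ θ := by
  rw [gaussHyp_eq (isGaussContinuation_integral hδ) (by linarith), ← mul_assoc,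
    div_mul_cancel₀ _ (by linarith), interfExponent, ← integral_const_mul]
  refine setIntegral_congr_fun measurableSet_Ioi fun v hv => ?_
  have hv1 : 1 < v := hv
  have hv0 : 0 < v := zero_lt_one.trans hv1
  have h1 : 1 < v ^ δ := Real.one_lt_rpow hv1 (by linarith)
  have h2 : v ^ δ + θ ≠ 0 := by linarith
  rw [Real.rpow_neg hv0.le]
  have h3 : 1 - -θ * (v ^ δ)⁻¹ = (v ^ δ + θ) / v ^ δ := by field_simp; ring
  rw [h3]
  field_simp

theorem continuousOn_interfExponent {δ : ℝ} (hδ : 1 < δ) :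
    ContinuousOn (interfExponent δ) (Ioi (-1)) := by
  have hc := (isGaussContinuation_integral hδ).1.continuousOn
  have h : ContinuousOn (fun θ : ℝ => θ / (δ - 1) *
      ((δ - 1) * ∫ v in Ioi (1 : ℝ), v ^ (-δ) / (1 - (-θ) * v ^ (-δ)))) (Ioi (-1)) := by
    refine (continuousOn_id.div_const _).mul (hc.comp continuousOn_neg ?_)
    intro θ hθ
    simp only [mem_Ioi, mem_Iio] at *
    linarith
  refine h.congr fun θ hθ => ?_
  rw [← interfExponent_eq_gaussHyp hδ hθ,
    gaussHyp_eq (isGaussContinuation_integral hδ) (by simp only [mem_Ioi] at hθ; linarith)]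

theorem integrableOn_interf {δ θ : ℝ} (hδ : 1 < δ) (hθ : -1 < θ) :
    IntegrableOn (fun v : ℝ => θ / (v ^ δ + θ)) (Ioi 1) := by
  have hε : 0 < min 1 (1 + θ) := lt_min one_pos (by linarith)
  refine ((integrableOn_rpow_neg hδ).const_mul (|θ| / min 1 (1 + θ))).mono'
    (Measurable.aestronglyMeasurable (by fun_prop)) ?_
  filter_upwards [ae_restrict_mem measurableSet_Ioi] with v hv
  have hv1 : 1 < v := hv
  have hv0 : 0 < v := zero_lt_one.trans hv1
  have h1 : 1 < v ^ δ := Real.one_lt_rpow hv1 (by linarith)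
  -- For negative `θ` this uses `v ^ δ ≥ 1`, so that `θ ≥ θ v ^ δ`.
  have h2 : min 1 (1 + θ) * v ^ δ ≤ v ^ δ + θ := by
    rcases le_total 0 θ with h | h
    · nlinarith [min_le_left 1 (1 + θ)]
    · nlinarith [min_le_right 1 (1 + θ)]
  rw [norm_div, Real.norm_eq_abs, Real.norm_eq_abs, abs_of_pos (by linarith : 0 < v ^ δ + θ),
    Real.rpow_neg hv0.le, div_mul_eq_mul_div, ← div_eq_mul_inv, div_div]
  rw [mul_comm (v ^ δ)]
  gcongr

theorem strictMonoOn_interfExponent {δ : ℝ} (hδ : 1 < δ) :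
    StrictMonoOn (interfExponent δ) (Ioi (-1)) := by
  intro θ₁ h₁ θ₂ h₂ hlt
  rw [interfExponent, interfExponent, ← sub_pos,
    ← integral_sub (integrableOn_interf hδ h₂) (integrableOn_interf hδ h₁)]
  have hpos : ∀ v ∈ Ioi (1 : ℝ), 0 < θ₂ / (v ^ δ + θ₂) - θ₁ / (v ^ δ + θ₁) := by
    intro v hv
    have hv1 : 1 < v := hv
    have h1 : 1 < v ^ δ := Real.one_lt_rpow hv1 (by linarith)
    simp only [mem_Ioi] at h₁ h₂
    rw [sub_pos, div_lt_div_iff₀ (by linarith) (by linarith)]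
    nlinarith
  rw [setIntegral_pos_iff_support_of_nonneg_ae]
  · refine lt_of_lt_of_le ?_ (measure_mono (subset_inter
      (fun v hv => (hpos v hv).ne') subset_rfl : Ioi (1 : ℝ) ⊆ _))
    simp
  · filter_upwards [ae_restrict_mem measurableSet_Ioi] with v hv using (hpos v hv).le
  · exact (integrableOn_interf hδ h₂).sub (integrableOn_interf hδ h₁)

theorem interfExponent_zero (δ : ℝ) : interfExponent δ 0 = 0 := by simp [interfExponent]

/-- The integrand is at least `1 / 2` as long as `v ^ δ ≤ θ`, so the integral is at least half the
length of `(1, θ ^ (1 / δ)]`. -/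
theorem tendsto_interfExponent_atTop {δ : ℝ} (hδ : 1 < δ) :
    Tendsto (interfExponent δ) atTop atTop := by
  have hδ0 : 0 < δ := by linarith
  have hle : ∀ᶠ θ : ℝ in atTop, (θ ^ (1 / δ) - 1) / 2 ≤ interfExponent δ θ := by
    filter_upwards [eventually_ge_atTop 1] with θ hθ
    have hr : 1 ≤ θ ^ (1 / δ) := Real.one_le_rpow hθ (by positivity)
    have hsub : Ioc 1 (θ ^ (1 / δ)) ⊆ Ioi (1 : ℝ) := fun v hv => hv.1
    have hint := integrableOn_interf hδ (by linarith : -1 < θ)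
    calc (θ ^ (1 / δ) - 1) / 2 = ∫ _ in Ioc 1 (θ ^ (1 / δ)), (1 / 2 : ℝ) := by
          rw [setIntegral_const, measureReal_def, Real.volume_Ioc,
            ENNReal.toReal_ofReal (by linarith), smul_eq_mul]
          ring
      _ ≤ ∫ v in Ioc 1 (θ ^ (1 / δ)), θ / (v ^ δ + θ) := by
          refine setIntegral_mono_on (by simp) (hint.mono_set hsub) measurableSet_Ioc ?_
          intro v hv
          have hv0 : 0 < v := zero_lt_one.trans hv.1
          have h1 : v ^ δ ≤ θ := by
            calc v ^ δ ≤ (θ ^ (1 / δ)) ^ δ := Real.rpow_le_rpow hv0.le hv.2 hδ0.le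
              _ = θ := by
                rw [← Real.rpow_mul (by linarith), one_div, inv_mul_cancel₀ hδ0.ne',
                  Real.rpow_one]
          have h2 : 0 < v ^ δ := Real.rpow_pos_of_pos hv0 _
          rw [div_le_div_iff₀ two_pos (by linarith)]
          linarith
      _ ≤ _ := by
          refine setIntegral_mono_set hint ?_ (ae_of_all _ hsub)
          filter_upwards [ae_restrict_mem measurableSet_Ioi] with v hv
          have hv0 : (0 : ℝ) < v := zero_lt_one.trans hv
          have h2 : 0 < v ^ δ := Real.rpow_pos_of_pos hv0 _
          have : 0 ≤ θ := by linarith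
          simp only [Pi.zero_apply]
          positivity
  refine tendsto_atTop_mono' _ hle ?_
  have := tendsto_rpow_atTop (y := 1 / δ) (by positivity)
  exact (tendsto_atTop_add_const_right _ (-1) this).atTop_div_const two_pos

/-! ### The equation for the maximum load -/

/-- The SIR threshold at load `t`. -/
noncomputable def sirThreshold (A : Access) (Q T t : ℝ) : ℝ :=
  (2 : ℝ) ^ (t * Q / (A.η * A.W * T)) - 1

section LoadFun

variable {A : Access} {Q T : ℝ}

theorem neg_one_lt_sirThreshold (A : Access) (Q T t : ℝ) : -1 < sirThreshold A Q T t := by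
  have := Real.rpow_pos_of_pos (two_pos : (0 : ℝ) < 2) (t * Q / (A.η * A.W * T))
  rw [sirThreshold]; linarith

theorem sirThreshold_zero (A : Access) (Q T : ℝ) : sirThreshold A Q T 0 = 0 := by
  simp [sirThreshold]

theorem strictMono_sirThreshold (hη : 0 < A.η) (hW : 0 < A.W) (hQ : 0 < Q) (hT : 0 < T) :
    StrictMono (sirThreshold A Q T) := by
  intro s t hst
  unfold sirThreshold
  have : s * Q / (A.η * A.W * T) < t * Q / (A.η * A.W * T) := by gcongr
  linarith [Real.rpow_lt_rpow_of_exponent_lt (by norm_num : (1 : ℝ) < 2) this]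

theorem loadFun_eq_interfExponent (hα : 2 < A.α) (t : ℝ) :
    loadFun A Q T t = interfExponent (A.α / 2) (sirThreshold A Q T t) := by
  rw [← interfExponent_eq_gaussHyp (by linarith) (neg_one_lt_sirThreshold A Q T t), loadFun]
  have h1 : (1 : ℝ) / (A.α / 2) = 2 / A.α := by rw [one_div_div]
  have h2 : A.α - 2 ≠ 0 := by linarith
  have h3 : A.α / 2 - 1 ≠ 0 := by linarith
  rw [h1, show 1 - (2 : ℝ) ^ (t * Q / (A.η * A.W * T)) = -sirThreshold A Q T t by
    rw [sirThreshold]; ring]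
  congr 1
  rw [Real.rpow_add two_pos, Real.rpow_one, sirThreshold, div_eq_div_iff h2 h3]
  ring

theorem strictMono_loadFun (hα : 2 < A.α) (hη : 0 < A.η) (hW : 0 < A.W) (hQ : 0 < Q)
    (hT : 0 < T) : StrictMono (loadFun A Q T) := by
  intro s t hst
  rw [loadFun_eq_interfExponent hα, loadFun_eq_interfExponent hα]
  exact strictMonoOn_interfExponent (by linarith) (neg_one_lt_sirThreshold A Q T s)
    (neg_one_lt_sirThreshold A Q T t) (strictMono_sirThreshold hη hW hQ hT hst)

theorem continuous_loadFun (hα : 2 < A.α) : Continuous (loadFun A Q T) := by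
  have h : loadFun A Q T = fun t => interfExponent (A.α / 2) (sirThreshold A Q T t) :=
    funext (loadFun_eq_interfExponent hα)
  rw [h]
  refine (continuousOn_interfExponent (by linarith)).comp_continuous ?_
    (neg_one_lt_sirThreshold A Q T)
  unfold sirThreshold
  have : (2 : ℝ) ≠ 0 := two_ne_zero
  fun_prop (disch := assumption)

theorem exists_loadFun_eq (hα : 2 < A.α) (hη : 0 < A.η) (hW : 0 < A.W) (hQ : 0 < Q)
    (hT : 0 < T) {c : ℝ} (hc : 0 ≤ c) : ∃ κ, 0 ≤ κ ∧ loadFun A Q T κ = c := by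
  have h0 : loadFun A Q T 0 = 0 := by
    rw [loadFun_eq_interfExponent hα, sirThreshold_zero, interfExponent_zero]
  have htop : Tendsto (loadFun A Q T) atTop atTop := by
    have h : loadFun A Q T = fun t => interfExponent (A.α / 2) (sirThreshold A Q T t) :=
      funext (loadFun_eq_interfExponent hα)
    rw [h]
    refine (tendsto_interfExponent_atTop (by linarith)).comp ?_
    unfold sirThreshold
    refine tendsto_atTop_add_const_right _ (-1) ?_
    refine (tendsto_rpow_atTop_of_base_gt_one 2 (by norm_num)).comp ?_
    exact (tendsto_id.atTop_mul_const hQ).atTop_div_const (by positivity)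
  obtain ⟨b, hb0, hb⟩ := ((eventually_ge_atTop 0).and (htop.eventually_ge_atTop c)).exists
  obtain ⟨κ, hκ, hκc⟩ := intermediate_value_Icc hb0 (continuous_loadFun hα).continuousOn
    (show c ∈ Icc (loadFun A Q T 0) (loadFun A Q T b) from ⟨h0.symm ▸ hc, hb⟩)
  exact ⟨κ, hκ.1, hκc⟩

end LoadFun

/-! ### Bisection for a strictly monotone function -/

theorem searchStep_bracket {F : ℝ → ℝ} (hF : StrictMono F) {κ : ℝ} {p : ℝ × ℝ}
    (h1 : p.1 ≤ κ) (h2 : κ ≤ p.2) :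
    (searchStep F (F κ) p).1 ≤ κ ∧ κ ≤ (searchStep F (F κ) p).2 ∧
      (searchStep F (F κ) p).2 - (searchStep F (F κ) p).1 ≤ (p.2 - p.1) / 2 := by
  unfold searchStep
  split_ifs with h h'
  · rw [hF.injective h]
    refine ⟨le_rfl, le_rfl, ?_⟩
    simp only; linarith
  · have := hF.lt_iff_lt.1 h'
    refine ⟨this.le, h2, ?_⟩
    simp only; linarith
  · have := hF.le_iff_le.1 (not_lt.1 h')
    refine ⟨h1, this, ?_⟩
    simp only; linarith

theorem searchStep_iterate {F : ℝ → ℝ} (hF : StrictMono F) {κ l h : ℝ}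
    (hl : l ≤ κ) (hh : κ ≤ h) (n : ℕ) :
    ((searchStep F (F κ))^[n] (l, h)).1 ≤ κ ∧ κ ≤ ((searchStep F (F κ))^[n] (l, h)).2 ∧
      ((searchStep F (F κ))^[n] (l, h)).2 - ((searchStep F (F κ))^[n] (l, h)).1
        ≤ (h - l) / 2 ^ n := by
  induction n with
  | zero => simpa using ⟨hl, hh⟩
  | succ n ih =>
    rw [Function.iterate_succ_apply']
    obtain ⟨h1, h2, h3⟩ := ih
    obtain ⟨g1, g2, g3⟩ := searchStep_bracket hF h1 h2
    refine ⟨g1, g2, g3.trans ?_⟩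
    rw [pow_succ, ← div_div]
    gcongr

end EdgeCaching

namespace EdgeCaching

/-! ### The law of the cell load -/

theorem gam_pos : 0 < gam := by unfold gam; norm_num

theorem loadPMF_pos {ρ : ℝ} (hρ : 0 < ρ) {k : ℕ} : 0 < loadPMF ρ k := by
  have h1 := gam_pos
  have h2 : 0 < Real.Gamma (k + gam) := Real.Gamma_pos_of_pos (by positivity)
  have h3 : 0 < Real.Gamma gam := Real.Gamma_pos_of_pos h1
  unfold loadPMF
  positivity

theorem measurable_poissonMeasure_singleton (n : ℕ) :
    Measurable fun r : ℝ≥0 => poissonMeasure r {n} := by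
  simp_rw [poissonMeasure_singleton]
  fun_prop

/-- Size-biasing raises the power of `x` by one and the Poisson weight raises it by `n`, with rate
`gam + ρ`; what remains is a gamma integral of shape `n + 1 + gam`. -/
theorem lintegral_taggedAreaLaw_poisson {ρ : ℝ} (hρ : 0 < ρ) (n : ℕ) :
    ∫⁻ x, poissonMeasure (Real.toNNReal (ρ * x)) {n} ∂taggedAreaLaw =
      ENNReal.ofReal (loadPMF ρ (n + 1)) := by
  have hg := gam_pos
  have hΓ : 0 < Real.Gamma gam := Real.Gamma_pos_of_pos hg
  have hm : Measurable fun x : ℝ => poissonMeasure (Real.toNNReal (ρ * x)) {n} :=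
    (measurable_poissonMeasure_singleton n).comp (by fun_prop)
  have hpdf : Measurable (gammaPDF gam gam) := (measurable_gammaPDFReal _ _).ennreal_ofReal
  rw [taggedAreaLaw, lintegral_withDensity_eq_lintegral_mul _ (by fun_prop) hm, gammaMeasure,
    lintegral_withDensity_eq_lintegral_mul _ hpdf (by fun_prop)]
  have hdens : ∀ x : ℝ, (gammaPDF gam gam * ((fun x => ENNReal.ofReal x) *
      fun x : ℝ => poissonMeasure (Real.toNNReal (ρ * x)) {n})) x =
      (Ioi (0 : ℝ)).indicator (fun x => ENNReal.ofReal
        (gam ^ gam / Real.Gamma gam * (ρ ^ n / n !) *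
          (x ^ ((n : ℝ) + 1 + gam - 1) * Real.exp (-((gam + ρ) * x))))) x := by
    intro x
    by_cases hx : 0 < x
    · rw [indicator_of_mem (show x ∈ Ioi (0 : ℝ) from hx)]
      simp only [Pi.mul_apply]
      rw [gammaPDF_of_nonneg hx.le, poissonMeasure_singleton,
        Real.coe_toNNReal _ (by positivity), ← ENNReal.ofReal_mul hx.le,
        ← ENNReal.ofReal_mul (by positivity)]
      congr 1
      rw [show (n : ℝ) + 1 + gam - 1 = (gam - 1) + 1 + n by ring, Real.rpow_add hx,
        Real.rpow_add hx, Real.rpow_one, Real.rpow_natCast,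
        show -((gam + ρ) * x) = -(gam * x) + -(ρ * x) by ring, Real.exp_add, mul_pow]
      ring
    · rw [indicator_of_notMem (show x ∉ Ioi (0 : ℝ) from hx)]
      simp [ENNReal.ofReal_of_nonpos (not_lt.1 hx)]
  simp_rw [hdens]
  have ha : 0 < (n : ℝ) + 1 + gam := by positivity
  have hr : 0 < gam + ρ := by positivity
  have hint := Real.integral_rpow_mul_exp_neg_mul_Ioi ha hr
  have hintble : IntegrableOn (fun x : ℝ => x ^ ((n : ℝ) + 1 + gam - 1) *
      Real.exp (-((gam + ρ) * x))) (Ioi 0) := by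
    -- A non-integrable function would have integral `0` by convention, but the known value is
    -- positive.
    refine not_not.1 fun h => ?_
    rw [integral_undef h] at hint
    have := Real.Gamma_pos_of_pos ha
    have : 0 < (1 / (gam + ρ)) ^ ((n : ℝ) + 1 + gam) * Real.Gamma ((n : ℝ) + 1 + gam) := by
      positivity
    linarith
  rw [lintegral_indicator measurableSet_Ioi, ← ofReal_integral_eq_lintegral_ofReal
    (hintble.const_mul _)]
  · rw [integral_const_mul, hint, loadPMF]
    congr 1
    rw [Real.div_rpow zero_le_one hr.le, Real.one_rpow]
    simp only [Nat.add_sub_cancel]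
    push_cast
    field_simp
  · filter_upwards [ae_restrict_mem measurableSet_Ioi] with x hx
    have hx' : (0 : ℝ) < x := hx
    simp only [Pi.zero_apply]
    positivity

variable {Ω : Type*} [MeasurableSpace Ω] {μ : Measure Ω} {J : ℕ} {N : Network Ω J}
  {lamU lamS s : ℝ} {L : ℕ} {q : Fin J → ℝ}

theorem Network.IsModel.load_law (hmodel : N.IsModel μ lamU lamS s L q) (hU : 0 < lamU)
    (hS : 0 < lamS) (n : ℕ) :
    μ {ω | N.others ω = n} = ENNReal.ofReal (loadPMF (lamU / lamS) (n + 1)) := by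
  have h := hmodel.others_law univ MeasurableSet.univ n
  simp only [mem_univ, true_and, preimage_univ, Measure.restrict_univ] at h
  have hm : Measurable fun x : ℝ => poissonMeasure (Real.toNNReal (lamU / lamS * x)) {n} :=
    (measurable_poissonMeasure_singleton n).comp (by fun_prop)
  rw [h, ← lintegral_taggedAreaLaw_poisson (by positivity), ← hmodel.area_law,
    lintegral_map hm (hmodel.area_meas.const_mul _)]
  refine lintegral_congr fun ω => ?_
  rw [← mul_assoc, div_mul_cancel₀ _ hS.ne']

theorem Network.IsModel.load_real (hmodel : N.IsModel μ lamU lamS s L q) (hU : 0 < lamU)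
    (hS : 0 < lamS) {k : ℕ} (hk : 1 ≤ k) :
    μ.real {ω | N.load ω = k} = loadPMF (lamU / lamS) k := by
  obtain ⟨n, rfl⟩ := Nat.exists_eq_add_of_le' hk
  have : {ω | N.load ω = n + 1} = {ω | N.others ω = n} := by
    ext ω; simp [Network.load]
  rw [this, measureReal_def, hmodel.load_law hU hS,
    ENNReal.toReal_ofReal (loadPMF_pos (by positivity)).le]

end EdgeCaching

namespace EdgeCaching

/-! ### The exponential tail `e^{-y}` for `y ∈ [0, ∞]` -/

/-- `e^{-y}`, with `e^{-∞} = 0`. -/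
noncomputable def expNeg (y : ℝ≥0∞) : ℝ≥0∞ := EReal.exp (-(y : EReal))

theorem expNeg_ofReal {x : ℝ} (hx : 0 ≤ x) :
    expNeg (ENNReal.ofReal x) = ENNReal.ofReal (Real.exp (-x)) := by
  rw [expNeg, EReal.coe_ennreal_ofReal, max_eq_left hx, ← EReal.coe_neg, EReal.exp_coe]

@[simp] theorem expNeg_zero : expNeg 0 = 1 := by simp [expNeg]

@[simp] theorem expNeg_top : expNeg ∞ = 0 := by simp [expNeg]

theorem expNeg_antitone : Antitone expNeg := by
  intro x y h
  refine EReal.exp_monotone ?_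
  rw [EReal.neg_le_neg_iff]
  exact_mod_cast h

theorem expNeg_le_one (y : ℝ≥0∞) : expNeg y ≤ 1 := by
  simpa using expNeg_antitone (zero_le (a := y))

theorem continuous_expNeg : Continuous expNeg :=
  ENNReal.continuous_exp.comp (continuous_neg.comp continuous_coe_ennreal_ereal)

theorem measurable_expNeg : Measurable expNeg := continuous_expNeg.measurable

theorem expNeg_add (x y : ℝ≥0∞) : expNeg (x + y) = expNeg x * expNeg y := by
  rw [expNeg, expNeg, expNeg, ← EReal.exp_add, EReal.coe_ennreal_add,
    EReal.neg_add (Or.inl (EReal.coe_ennreal_ne_bot x)) (Or.inr (EReal.coe_ennreal_ne_bot y)),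
    sub_eq_add_neg]

theorem expNeg_sum {ι : Type*} (s : Finset ι) (f : ι → ℝ≥0∞) :
    expNeg (∑ i ∈ s, f i) = ∏ i ∈ s, expNeg (f i) := by
  induction s using Finset.cons_induction with
  | empty => simp
  | cons a s ha ih => rw [Finset.sum_cons, Finset.prod_cons, expNeg_add, ih]

theorem expMeasure_one_tail {y : ℝ≥0∞} (hy : y ≠ 0) :
    expMeasure 1 {x | y ≤ ENNReal.ofReal x} = expNeg y := by
  have := isProbabilityMeasure_expMeasure one_pos
  rcases eq_or_ne y ∞ with rfl | hy'
  · simp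
  obtain ⟨r, hr, rfl⟩ : ∃ r : ℝ, 0 < r ∧ y = ENNReal.ofReal r :=
    ⟨y.toReal, ENNReal.toReal_pos hy hy', (ENNReal.ofReal_toReal hy').symm⟩
  have h1 : {x : ℝ | ENNReal.ofReal r ≤ ENNReal.ofReal x} = Ici r := by
    ext x
    simp only [mem_ofPred_eq, mem_Ici]
    rw [ENNReal.ofReal_le_ofReal_iff']
    exact ⟨fun h => h.elim id fun h => absurd h hr.not_ge, Or.inl⟩
  have h2 : expMeasure 1 (Ici r) = expMeasure 1 (Ioi r) :=
    measure_congr (((withDensity_absolutelyContinuous volume (gammaPDF 1 1)).ae_eq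
      Ioi_ae_eq_Ici).symm)
  have h3 : expMeasure 1 (Iic r) = ENNReal.ofReal (1 - Real.exp (-r)) := by
    rw [expMeasure, gammaMeasure, withDensity_apply _ measurableSet_Iic]
    have := lintegral_exponentialPDF_eq_antiDeriv one_pos r
    rw [if_pos hr.le, one_mul] at this
    exact this
  rw [h1, h2, ← compl_Iic, prob_compl_eq_one_sub measurableSet_Iic, h3, expNeg_ofReal hr.le,
    ← ENNReal.ofReal_one, ← ENNReal.ofReal_sub _ (by simp [hr.le])]
  congr 1; ring

/-- Multiplying the unit exponential density by `e^{-wx}` gives `1 / (1 + w)` times the exponential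
density of rate `1 + w`. -/
theorem lintegral_expMeasure_expNeg {w : ℝ} (hw : 0 ≤ w) :
    ∫⁻ x, expNeg (ENNReal.ofReal w * ENNReal.ofReal x) ∂expMeasure 1 =
      ENNReal.ofReal (1 / (1 + w)) := by
  have hpdf : Measurable (gammaPDF 1 1) := (measurable_gammaPDFReal _ _).ennreal_ofReal
  have hm : Measurable fun x : ℝ => expNeg (ENNReal.ofReal w * ENNReal.ofReal x) :=
    measurable_expNeg.comp (by fun_prop)
  have h1w : 0 < 1 + w := by linarith
  have hpdf' : Measurable (exponentialPDF (1 + w)) :=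
    (measurable_exponentialPDFReal _).ennreal_ofReal
  rw [expMeasure, gammaMeasure, lintegral_withDensity_eq_lintegral_mul _ hpdf hm]
  have : ∀ x : ℝ, (gammaPDF 1 1 * fun x => expNeg (ENNReal.ofReal w * ENNReal.ofReal x)) x =
      ENNReal.ofReal (1 / (1 + w)) * exponentialPDF (1 + w) x := by
    intro x
    rw [Pi.mul_apply, show gammaPDF 1 1 x = exponentialPDF 1 x from rfl]
    rcases lt_or_ge x 0 with hx | hx
    · simp [exponentialPDF_of_neg hx]
    · rw [exponentialPDF_of_nonneg hx, exponentialPDF_of_nonneg hx, ← ENNReal.ofReal_mul hw,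
        expNeg_ofReal (by positivity), ← ENNReal.ofReal_mul (by positivity),
        ← ENNReal.ofReal_mul (by positivity), mul_assoc, ← Real.exp_add]
      congr 1
      field_simp
      congr 1; ring
  simp_rw [this]
  rw [lintegral_const_mul _ hpdf', lintegral_exponentialPDF_eq_one h1w, mul_one]

/-! ### Marks -/

/-- The law of `h · 1_{hit}` for a unit exponential gain `h` and an independent event of
probability `p`, described by its tail and its Laplace transform. -/
structure IsThinnedExp {Ω : Type*} [MeasurableSpace Ω] (μ : Measure Ω) (p : ℝ)
    (v : Ω → ℝ≥0∞) : Prop where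
  measurable : Measurable v
  tail : ∀ y : ℝ≥0∞, y ≠ 0 → μ {ω | y ≤ v ω} = ENNReal.ofReal p * expNeg y
  laplace : ∀ w : ℝ, 0 ≤ w →
    ∫⁻ ω, expNeg (ENNReal.ofReal w * v ω) ∂μ = ENNReal.ofReal (1 - p * (w / (1 + w)))

/-- The weighted sum of the marks `y i`, `i ≠ o`. -/
noncomputable def weightedSum (o : ℕ) (a : ℕ → ℝ) (y : ℕ → ℝ≥0∞) : ℝ≥0∞ :=
  ∑' i, if i = o then 0 else ENNReal.ofReal (a i) * y i

theorem measurable_weightedSum {Ω : Type*} {_ : MeasurableSpace Ω} {v : ℕ → Ω → ℝ≥0∞} {o : ℕ}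
    (hv : ∀ i, i ≠ o → Measurable (v i)) (a : ℕ → ℝ) :
    Measurable fun ω => weightedSum o a (fun i => v i ω) := by
  refine Measurable.tsum fun i => ?_
  by_cases h : i = o
  · simp [h]
  · simpa [h] using (hv i h).const_mul _

section Marks

variable {Ω : Type*} [MeasurableSpace Ω] {μ : Measure Ω} {p : ℝ}

open Classical in
-- Independence factors every integral over `H` into `p` times an integral against the exponential
-- law. Off `H` the variable is `0`, which adds `1 - p` to the Laplace transform and nothing to the
-- tail at `y ≠ 0`.
theorem isThinnedExp_of_indep [IsProbabilityMeasure μ] {h : Ω → ℝ} {H : Set Ω} (hh : Measurable h)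
    (hlaw : μ.map h = expMeasure 1) (hH : MeasurableSet H)
    (hp : μ H = ENNReal.ofReal p) (hp0 : 0 ≤ p)
    (hind : IndepFun h (H.indicator fun _ => (1 : ℝ≥0∞)) μ) :
    IsThinnedExp μ p (fun ω => if ω ∈ H then ENNReal.ofReal (h ω) else 0) := by
  have hm1 : Measurable (H.indicator fun _ => (1 : ℝ≥0∞)) := measurable_const.indicator hH
  have key : ∀ F : ℝ → ℝ≥0∞, Measurable F →
      ∫⁻ ω in H, F (h ω) ∂μ = ENNReal.ofReal p * ∫⁻ x, F x ∂expMeasure 1 := by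
    intro F hF
    have h1 := lintegral_mul_eq_lintegral_mul_lintegral_of_indepFun (hF.comp hh) hm1
      (hind.comp hF measurable_id)
    have h2 : ((F ∘ h) * H.indicator fun _ => (1 : ℝ≥0∞)) = H.indicator (fun ω => F (h ω)) := by
      ext ω
      by_cases hω : ω ∈ H <;> simp [hω]
    rw [h2, lintegral_indicator hH, lintegral_indicator hH] at h1
    simp only [lintegral_const, Measure.restrict_apply, MeasurableSet.univ, univ_inter, one_mul,
      hp] at h1
    rw [h1, ← hlaw, lintegral_map hF hh, mul_comm]
    rfl
  have hp1 : p ≤ 1 := by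
    have : μ H ≤ 1 := prob_le_one
    rw [hp] at this
    exact ENNReal.ofReal_le_one.1 this
  refine ⟨Measurable.ite hH hh.ennreal_ofReal measurable_const, ?_, ?_⟩
  · intro y hy
    have hset : {ω | y ≤ if ω ∈ H then ENNReal.ofReal (h ω) else 0} =
        (h ⁻¹' {x | y ≤ ENNReal.ofReal x}) ∩ H := by
      ext ω
      by_cases hω : ω ∈ H <;> simp [hω, hy]
    have hms : MeasurableSet {x : ℝ | y ≤ ENNReal.ofReal x} :=
      measurableSet_le measurable_const ENNReal.measurable_ofReal
    have := key ({x | y ≤ ENNReal.ofReal x}.indicator 1) (measurable_one.indicator hms)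
    rw [lintegral_indicator_one hms, expMeasure_one_tail hy] at this
    rw [hset, ← this, ← Measure.restrict_apply (hh hms), ← lintegral_indicator_one (hh hms)]
    rfl
  · intro w hw
    have hm : Measurable fun x : ℝ => expNeg (ENNReal.ofReal w * ENNReal.ofReal x) :=
      measurable_expNeg.comp (by fun_prop)
    rw [← lintegral_add_compl _ hH, setLIntegral_congr_fun
      (g := fun ω => expNeg (ENNReal.ofReal w * ENNReal.ofReal (h ω))) hH, key _ hm,
      lintegral_expMeasure_expNeg hw, setLIntegral_congr_fun (g := fun _ => 1) hH.compl]
    · rw [lintegral_const, one_mul, Measure.restrict_apply MeasurableSet.univ, univ_inter,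
        prob_compl_eq_one_sub hH, hp, ← ENNReal.ofReal_one, ← ENNReal.ofReal_sub _ hp0,
        ← ENNReal.ofReal_mul hp0, ← ENNReal.ofReal_add (by positivity) (by linarith)]
      congr 1
      have : 1 + w ≠ 0 := by positivity
      field_simp; ring
    · intro ω hω
      simp only
      rw [if_neg hω]; simp
    · intro ω hω
      simp only
      rw [if_pos hω]

variable {v : ℕ → Ω → ℝ≥0∞}

theorem lintegral_expNeg_sum (hv : ∀ i, IsThinnedExp μ p (v i)) (hind : iIndepFun v μ)
    {a : ℕ → ℝ} (ha : ∀ i, 0 ≤ a i) (s : Finset ℕ) :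
    ∫⁻ ω, expNeg (∑ i ∈ s, ENNReal.ofReal (a i) * v i ω) ∂μ =
      ∏ i ∈ s, ENNReal.ofReal (1 - p * (a i / (1 + a i))) := by
  simp_rw [expNeg_sum]
  have hm : ∀ i, Measurable fun y : ℝ≥0∞ => expNeg (ENNReal.ofReal (a i) * y) :=
    fun i => measurable_expNeg.comp (by fun_prop)
  have := lintegral_prod_eq_prod_lintegral_of_indepFun s
    (fun i ω => expNeg (ENNReal.ofReal (a i) * v i ω)) (hind.comp _ hm)
    (fun i => (hm i).comp (hv i).measurable)
  rw [this]
  exact Finset.prod_congr rfl fun i _ => (hv i).laplace _ (ha i)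

theorem lintegral_expNeg_weightedSum_le (hv : ∀ i, IsThinnedExp μ p (v i))
    (hind : iIndepFun v μ) {a : ℕ → ℝ} (ha : ∀ i, 0 ≤ a i) {o : ℕ} {s : Finset ℕ} (hs : o ∉ s) :
    ∫⁻ ω, expNeg (weightedSum o a (fun i => v i ω)) ∂μ ≤
      ∏ i ∈ s, ENNReal.ofReal (1 - p * (a i / (1 + a i))) := by
  rw [← lintegral_expNeg_sum hv hind ha]
  refine lintegral_mono fun ω => expNeg_antitone ?_
  refine le_trans (le_of_eq (Finset.sum_congr rfl fun i hi => ?_)) (ENNReal.sum_le_tsum s)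
  rw [if_neg]
  rintro rfl; exact hs hi

/-- Finite partial sums have product transforms; dominated convergence passes to the series. With
the opposite bound, the transform is the infimum of the finite products. -/
theorem le_lintegral_expNeg_weightedSum [IsProbabilityMeasure μ] (hv : ∀ i, IsThinnedExp μ p (v i))
    (hind : iIndepFun v μ) {a : ℕ → ℝ} (ha : ∀ i, 0 ≤ a i) {o : ℕ} {c : ℝ≥0∞}
    (hc : ∀ s : Finset ℕ, o ∉ s → c ≤ ∏ i ∈ s, ENNReal.ofReal (1 - p * (a i / (1 + a i)))) :
    c ≤ ∫⁻ ω, expNeg (weightedSum o a (fun i => v i ω)) ∂μ := by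
  have hlim : Tendsto (fun n : ℕ => ∫⁻ ω, expNeg (∑ i ∈ (Finset.range n).erase o,
      ENNReal.ofReal (a i) * v i ω) ∂μ) atTop
      (𝓝 (∫⁻ ω, expNeg (weightedSum o a (fun i => v i ω)) ∂μ)) := by
    refine tendsto_lintegral_of_dominated_convergence (fun _ => 1) ?_ ?_ (by simp) ?_
    · intro n
      exact measurable_expNeg.comp (Finset.measurable_sum _ fun i _ =>
        (hv i).measurable.const_mul _)
    · exact fun n => ae_of_all _ fun ω => expNeg_le_one _
    · refine ae_of_all _ fun ω => (continuous_expNeg.tendsto _).comp ?_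
      refine (ENNReal.tendsto_nat_tsum _).congr fun n => ?_
      rw [← Finset.filter_ne', Finset.sum_filter]
      exact Finset.sum_congr rfl fun i _ => by by_cases h : i = o <;> simp [h]
  refine ge_of_tendsto' hlim fun n => ?_
  rw [lintegral_expNeg_sum hv hind ha]
  exact hc _ (Finset.notMem_erase _ _)

theorem indepFun_weightedSum (hv : ∀ i, IsThinnedExp μ p (v i)) (hind : iIndepFun v μ)
    (o : ℕ) (a : ℕ → ℝ) : IndepFun (v o) (fun ω => weightedSum o a (fun i => v i ω)) μ := by
  have h := indep_iSup_of_disjoint (fun i => (hv i).measurable.comap_le) hind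
    (S := {o}) (T := {o}ᶜ) disjoint_compl_right
  rw [IndepFun_iff_Indep]
  refine indep_of_indep_of_le_left (indep_of_indep_of_le_right h ?_) ?_
  · rw [← measurable_iff_comap_le]
    refine measurable_weightedSum (fun i hi => ?_) a
    rw [measurable_iff_comap_le]
    exact le_iSup₂_of_le i hi le_rfl
  · exact le_iSup₂_of_le o rfl le_rfl

/-- The weighted sum omits the mark `v o`, hence is independent of it, and Fubini integrates out `v
o` first. -/
theorem measure_weightedSum_le_eq [IsProbabilityMeasure μ] (hv : ∀ i, IsThinnedExp μ p (v i)) (hind : iIndepFun v μ)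
    (o : ℕ) (a : ℕ → ℝ) :
    μ {ω | weightedSum o a (fun i => v i ω) ≤ v o ω} =
      ∫⁻ ω, μ {ω' | weightedSum o a (fun i => v i ω) ≤ v o ω'} ∂μ := by
  have hY := measurable_weightedSum (fun i (_ : i ≠ o) => (hv i).measurable) a
  have hms : MeasurableSet {z : ℝ≥0∞ × ℝ≥0∞ | z.2 ≤ z.1} :=
    measurableSet_le measurable_snd measurable_fst
  have hprod := (indepFun_iff_map_prod_eq_prod_map_map (hv o).measurable.aemeasurable
    hY.aemeasurable).1 (indepFun_weightedSum hv hind o a)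
  have : IsProbabilityMeasure (μ.map (v o)) :=
    Measure.isProbabilityMeasure_map (hv o).measurable.aemeasurable
  have : IsProbabilityMeasure (μ.map fun ω => weightedSum o a (fun i => v i ω)) :=
    Measure.isProbabilityMeasure_map hY.aemeasurable
  have h1 : {ω | weightedSum o a (fun i => v i ω) ≤ v o ω} =
      (fun ω => (v o ω, weightedSum o a (fun i => v i ω))) ⁻¹' {z | z.2 ≤ z.1} := rfl
  rw [h1, ← Measure.map_apply ((hv o).measurable.prodMk hY) hms, hprod,
    Measure.prod_apply_symm hms, lintegral_map (measurable_measure_prodMk_right hms) hY]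
  refine lintegral_congr fun ω => ?_
  rw [Measure.map_apply (hv o).measurable (measurable_prodMk_right hms)]
  rfl

/-- The tail formula fails at `y = 0`, where the mark may have an atom; the last term pays for this,
and it vanishes after averaging over the positions. -/
theorem measure_weightedSum_le [IsProbabilityMeasure μ] (hv : ∀ i, IsThinnedExp μ p (v i)) (hind : iIndepFun v μ)
    (o : ℕ) (a : ℕ → ℝ) :
    μ {ω | weightedSum o a (fun i => v i ω) ≤ v o ω} ≤
      ENNReal.ofReal p * ∫⁻ ω, expNeg (weightedSum o a (fun i => v i ω)) ∂μ +
        μ {ω | weightedSum o a (fun i => v i ω) = 0} := by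
  have hY := measurable_weightedSum (fun i (_ : i ≠ o) => (hv i).measurable) a
  have hE : Measurable fun ω => expNeg (weightedSum o a (fun i => v i ω)) :=
    measurable_expNeg.comp hY
  have h0 : MeasurableSet {ω | weightedSum o a (fun i => v i ω) = 0} :=
    hY (measurableSet_singleton 0)
  rw [measure_weightedSum_le_eq hv hind, ← lintegral_indicator_one h0,
    ← lintegral_const_mul _ hE,
    ← lintegral_add_left (hE.const_mul _)]
  refine lintegral_mono fun ω => ?_
  by_cases h : weightedSum o a (fun i => v i ω) = 0
  · rw [indicator_of_mem (show ω ∈ {ω | weightedSum o a (fun i => v i ω) = 0} from h)]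
    exact le_add_left prob_le_one
  · rw [(hv o).tail _ h]
    exact le_self_add

theorem le_measure_weightedSum [IsProbabilityMeasure μ] (hv : ∀ i, IsThinnedExp μ p (v i)) (hind : iIndepFun v μ)
    (hp1 : p ≤ 1) (o : ℕ) (a : ℕ → ℝ) :
    ENNReal.ofReal p * ∫⁻ ω, expNeg (weightedSum o a (fun i => v i ω)) ∂μ ≤
      μ {ω | weightedSum o a (fun i => v i ω) ≤ v o ω} := by
  have hY := measurable_weightedSum (fun i (_ : i ≠ o) => (hv i).measurable) a
  have hE : Measurable fun ω => expNeg (weightedSum o a (fun i => v i ω)) :=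
    measurable_expNeg.comp hY
  rw [measure_weightedSum_le_eq hv hind, ← lintegral_const_mul _ hE]
  refine lintegral_mono fun ω => ?_
  by_cases h : weightedSum o a (fun i => v i ω) = 0
  · simpa [h] using hp1
  · rw [(hv o).tail _ h]

end Marks

end EdgeCaching

namespace EdgeCaching

/-! ### Poisson processes on the half-line, observed through cells -/

/-- Index of a smallest entry of the sequence `t`. -/
noncomputable def argmin (t : ℕ → ℝ) : ℕ := sInf {n | ∀ i, t n ≤ t i}

/-- Number of entries of `t` in `[jΔ, (j+1)Δ)`. -/
noncomputable def cellCount (Δ : ℝ) (t : ℕ → ℝ) (j : ℕ) : ℕ∞ := {i | ⌊t i / Δ⌋₊ = j}.encard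

/-- The `k`-th cell contains exactly one entry of `t`, and the preceding cells are empty. -/
def FirstCell (Δ : ℝ) (k : ℕ) (t : ℕ → ℝ) : Prop :=
  (∀ j < k, cellCount Δ t j = 0) ∧ cellCount Δ t k = 1

/-- The random points `T 0, T 1, …` of `[0, ∞)` enumerate a Poisson process of unit rate. -/
structure IsUnitPoisson {Ω : Type*} [MeasurableSpace Ω] (μ : Measure Ω) (T : ℕ → Ω → ℝ) :
    Prop where
  measurable : ∀ i, Measurable (T i)
  nonneg : ∀ i ω, 0 ≤ T i ω
  count_law : ∀ Δ : ℝ, 0 < Δ → ∀ j k : ℕ,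
    μ {ω | cellCount Δ (fun i => T i ω) j = k} = poissonMeasure Δ.toNNReal {k}
  count_indep : ∀ Δ : ℝ, 0 < Δ →
    iIndepFun (fun j ω => cellCount Δ (fun i => T i ω) j) μ

/-! ### Pathwise bounds when the first occupied cell holds one point -/

section Deterministic

variable {t : ℕ → ℝ} {Δ : ℝ}

theorem finite_cell (hfin : ∀ j, cellCount Δ t j ≠ ⊤) (j : ℕ) : {i | ⌊t i / Δ⌋₊ = j}.Finite :=
  Set.encard_ne_top_iff.1 (hfin j)

theorem finite_cells_lt (hfin : ∀ j, cellCount Δ t j ≠ ⊤) (n : ℕ) :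
    {i | ⌊t i / Δ⌋₊ < n}.Finite := by
  have : {i | ⌊t i / Δ⌋₊ < n} = ⋃ j ∈ Finset.range n, {i | ⌊t i / Δ⌋₊ = j} := by
    ext i; simp
  rw [this]
  exact Set.Finite.biUnion (Finset.finite_toSet _) fun j _ => finite_cell hfin j

theorem argmin_le (hΔ : 0 < Δ) (hfin : ∀ j, cellCount Δ t j ≠ ⊤) (i : ℕ) :
    t (argmin t) ≤ t i := by
  have hne : {n | ∀ i, t n ≤ t i}.Nonempty := by
    -- Only finitely many entries lie in the cells up to that of `t 0`, so a minimum exists there;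
    -- all other entries exceed `t 0`.
    have hf := finite_cells_lt hfin (⌊t 0 / Δ⌋₊ + 1)
    obtain ⟨n, hn, hmin⟩ := Set.exists_min_image _ t hf ⟨0, by simp⟩
    refine ⟨n, fun i => ?_⟩
    by_cases hi : ⌊t i / Δ⌋₊ < ⌊t 0 / Δ⌋₊ + 1
    · exact hmin i hi
    · refine (hmin 0 (by simp)).trans ?_
      by_contra hlt
      exact hi (Nat.lt_succ_of_le (Nat.floor_le_floor
        (div_le_div_of_nonneg_right (not_le.1 hlt).le hΔ.le)))
  exact Nat.sInf_mem hne i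

theorem FirstCell.floor_argmin (hΔ : 0 < Δ) (hfin : ∀ j, cellCount Δ t j ≠ ⊤) {k : ℕ}
    (h : FirstCell Δ k t) :
    ⌊t (argmin t) / Δ⌋₊ = k ∧ ∀ i, i ≠ argmin t → k + 1 ≤ ⌊t i / Δ⌋₊ := by
  obtain ⟨i₀, hi₀⟩ := Set.encard_eq_one.1 h.2
  have hcell : ∀ i, k ≤ ⌊t i / Δ⌋₊ := by
    intro i
    by_contra hlt
    have := h.1 _ (not_le.1 hlt)
    rw [cellCount, Set.encard_eq_zero] at this
    exact (this ▸ (rfl : i ∈ {i' | ⌊t i' / Δ⌋₊ = ⌊t i / Δ⌋₊}) : i ∈ (∅ : Set ℕ))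
  have hi₀k : ⌊t i₀ / Δ⌋₊ = k := by
    have : i₀ ∈ ({i₀} : Set ℕ) := rfl
    rw [← hi₀] at this
    exact this
  have ho : ⌊t (argmin t) / Δ⌋₊ = k := by
    refine le_antisymm ?_ (hcell _)
    rw [← hi₀k]
    exact Nat.floor_le_floor (div_le_div_of_nonneg_right (argmin_le hΔ hfin i₀) hΔ.le)
  refine ⟨ho, fun i hi => lt_of_le_of_ne (hcell i) fun hik => hi ?_⟩
  have h1 : i ∈ ({i₀} : Set ℕ) := hi₀ ▸ (hik.symm : ⌊t i / Δ⌋₊ = k)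
  have h2 : argmin t ∈ ({i₀} : Set ℕ) := hi₀ ▸ ho
  rw [mem_singleton_iff] at h1 h2
  rw [h1, h2]

theorem cell_bounds (hΔ : 0 < Δ) (ht : ∀ i, 0 ≤ t i) {i j : ℕ} (h : ⌊t i / Δ⌋₊ = j) :
    j * Δ ≤ t i ∧ t i < (j + 1) * Δ := by
  have h0 : 0 ≤ t i / Δ := div_nonneg (ht i) hΔ.le
  have h1 := Nat.floor_le h0
  have h2 := Nat.lt_floor_add_one (t i / Δ)
  rw [h] at h1 h2
  exact ⟨(le_div_iff₀ hΔ).1 h1, (div_lt_iff₀ hΔ).1 h2⟩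

theorem prod_cells (hfin : ∀ j, cellCount Δ t j ≠ ⊤) (k m : ℕ) (b : ℕ → ℝ≥0∞) :
    ∏ i ∈ (finite_cells_lt hfin (k + 1 + m)).toFinset with k + 1 ≤ ⌊t i / Δ⌋₊,
      b (⌊t i / Δ⌋₊ - (k + 1)) =
    ∏ l ∈ Finset.range m, b l ^ (cellCount Δ t (k + 1 + l)).toNat := by
  rw [← Finset.prod_fiberwise_of_maps_to (t := Finset.range m)
    (g := fun i => ⌊t i / Δ⌋₊ - (k + 1))]
  · refine Finset.prod_congr rfl fun l hl => ?_
    rw [Finset.prod_congr rfl (g := fun _ => b l), Finset.prod_const]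
    · congr 1
      rw [cellCount, ← Set.ncard_def, ← Set.ncard_coe_finset]
      congr 1
      ext i
      simp only [Finset.coe_filter, Finset.mem_filter, Set.Finite.mem_toFinset, mem_ofPred_eq]
      have := Finset.mem_range.1 hl
      omega
    · intro i hi
      rw [(Finset.mem_filter.1 hi).2]
  · intro i hi
    simp only [Finset.mem_filter, Set.Finite.mem_toFinset, mem_ofPred_eq] at hi
    rw [Finset.mem_range]
    omega

/-- Infimum of the finite products of `f (tₒ / tᵢ)` over indices `i ≠ o`, where `tₒ` is the
smallest entry of `t`. -/
noncomputable def ratioProd (f : ℝ → ℝ) (t : ℕ → ℝ) : ℝ≥0∞ :=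
  ⨅ (s : Finset ℕ) (_ : argmin t ∉ s), ∏ i ∈ s, ENNReal.ofReal (f (t (argmin t) / t i))

theorem ratioProd_le_one (f : ℝ → ℝ) (t : ℕ → ℝ) : ratioProd f t ≤ 1 := by
  refine (iInf₂_le ∅ (Finset.notMem_empty _)).trans ?_
  simp

variable {f : ℝ → ℝ}

/-- With the minimum in cell `k` and `t i` in cell `k + 1 + l`, the ratio is at least `k / (k + 2 +
l)`, and `f` decreases. The infimum is tested on the points of finitely many cells. -/
theorem ratioProd_le_of_firstCell (hf : AntitoneOn f (Ici 0)) (hΔ : 0 < Δ) (ht : ∀ i, 0 ≤ t i)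
    (hfin : ∀ j, cellCount Δ t j ≠ ⊤) {k : ℕ} (h : FirstCell Δ k t) (m : ℕ) :
    ratioProd f t ≤ ∏ l ∈ Finset.range m,
      ENNReal.ofReal (f (k / (k + 2 + l))) ^ (cellCount Δ t (k + 1 + l)).toNat := by
  obtain ⟨ho, hne⟩ := h.floor_argmin hΔ hfin
  rw [← prod_cells hfin k m (fun l => ENNReal.ofReal (f (k / (k + 2 + l))))]
  refine (iInf₂_le _ ?_).trans (Finset.prod_le_prod' fun i hi => ?_)
  · simp only [Finset.mem_filter, ho]; omega
  · have hi' := (Finset.mem_filter.1 hi).2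
    obtain ⟨l, hl⟩ := Nat.exists_eq_add_of_le hi'
    have h1 := cell_bounds hΔ ht ho
    have h2 := cell_bounds hΔ ht hl
    rw [hl, Nat.add_sub_cancel_left]
    push_cast at h2
    have hti : 0 < t i := lt_of_lt_of_le (by positivity) h2.1
    refine ENNReal.ofReal_le_ofReal (hf (mem_Ici.2 (by positivity))
      (mem_Ici.2 (div_nonneg (ht _) hti.le)) ?_)
    rw [div_le_div_iff₀ (by positivity) hti]
    calc (k : ℝ) * t i ≤ k * (((k : ℝ) + 1 + l + 1) * Δ) := by gcongr; exact h2.2.le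
      _ = k * Δ * (k + 2 + l) := by ring
      _ ≤ t (argmin t) * (k + 2 + l) := by gcongr; exact h1.1

/-- Here the ratio is at most `(k + 1) / (k + 1 + l)`. A finite index set is enlarged to all points
of finitely many cells, which only lowers a product of factors at most `1`. -/
theorem le_ratioProd_of_firstCell (hf : AntitoneOn f (Ici 0)) (hf1 : ∀ x, 0 ≤ x → f x ≤ 1)
    (hΔ : 0 < Δ) (ht : ∀ i, 0 ≤ t i)
    (hfin : ∀ j, cellCount Δ t j ≠ ⊤) {k : ℕ} (h : FirstCell Δ k t) :
    ⨅ m : ℕ, ∏ l ∈ Finset.range m, ENNReal.ofReal (f ((k + 1) / (k + 1 + l))) ^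
      (cellCount Δ t (k + 1 + l)).toNat ≤ ratioProd f t := by
  obtain ⟨ho, hne⟩ := h.floor_argmin hΔ hfin
  refine le_iInf₂ fun s hs => ?_
  obtain ⟨m, hm⟩ : ∃ m, ∀ i ∈ s, ⌊t i / Δ⌋₊ < m :=
    ⟨s.sup (fun i => ⌊t i / Δ⌋₊) + 1, fun i hi =>
      Nat.lt_succ_of_le (Finset.le_sup (f := fun i => ⌊t i / Δ⌋₊) hi)⟩
  refine (iInf_le _ m).trans ?_
  rw [← prod_cells hfin k m (fun l => ENNReal.ofReal (f ((k + 1) / (k + 1 + l))))]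
  refine le_trans (Finset.prod_le_prod_of_subset_of_le_one' (s := s) ?_ ?_)
    (Finset.prod_le_prod' fun i hi => ?_)
  · intro i hi
    have h1 := hm i hi
    have h2 := hne i (fun h => hs (h ▸ hi))
    simp only [Finset.mem_filter, Set.Finite.mem_toFinset, mem_ofPred_eq]
    omega
  · intro i _ _
    exact ENNReal.ofReal_le_one.2 (hf1 _ (by positivity))
  · obtain ⟨l, hl⟩ := Nat.exists_eq_add_of_le (hne i (fun h => hs (h ▸ hi)))
    have h1 := cell_bounds hΔ ht ho
    have h2 := cell_bounds hΔ ht hl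
    rw [hl, Nat.add_sub_cancel_left]
    push_cast at h2
    have hti : 0 < t i := lt_of_lt_of_le (by positivity) h2.1
    refine ENNReal.ofReal_le_ofReal (hf (mem_Ici.2 (div_nonneg (ht _) hti.le))
      (mem_Ici.2 (by positivity)) ?_)
    rw [div_le_div_iff₀ hti (by positivity)]
    calc t (argmin t) * (k + 1 + l) ≤ (((k : ℝ) + 1) * Δ) * (k + 1 + l) := by
          gcongr; exact h1.2.le
      _ = (k + 1) * (((k : ℝ) + 1 + l) * Δ) := by ring
      _ ≤ (k + 1) * t i := by gcongr; exact h2.1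

end Deterministic

end EdgeCaching

namespace EdgeCaching

/-! ### Averaging the cell products over the Poisson counts -/

theorem lintegral_poissonMeasure_pow {Δ a : ℝ} (hΔ : 0 ≤ Δ) (ha : 0 ≤ a) :
    ∫⁻ n, ENNReal.ofReal a ^ n ∂poissonMeasure Δ.toNNReal =
      ENNReal.ofReal (Real.exp (-(Δ * (1 - a)))) := by
  have h1 : HasSum (fun n : ℕ => Real.exp (-Δ) * Δ ^ n / n ! * a ^ n)
      (Real.exp (-(Δ * (1 - a)))) := by
    have := (NormedSpace.expSeries_div_hasSum_exp (Δ * a)).mul_left (Real.exp (-Δ))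
    rw [← Real.exp_eq_exp_ℝ, ← Real.exp_add] at this
    convert! this using 1
    · ext n; rw [mul_pow]; ring
    · congr 1; ring
  rw [lintegral_countable', ← h1.tsum_eq,
    ENNReal.ofReal_tsum_of_nonneg (fun n => by positivity) h1.summable]
  refine tsum_congr fun n => ?_
  rw [poissonMeasure_singleton, ← ENNReal.ofReal_pow ha, Real.coe_toNNReal _ hΔ,
    ← ENNReal.ofReal_mul (by positivity), mul_comm]

theorem tsum_ofReal_geometric {a r : ℝ} (ha : 0 ≤ a) (hr0 : 0 ≤ r) (hr1 : r < 1) :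
    ∑' k : ℕ, ENNReal.ofReal (a * r ^ k) = ENNReal.ofReal (a / (1 - r)) := by
  have h := (hasSum_geometric_of_lt_one hr0 hr1).mul_left a
  rw [← ENNReal.ofReal_tsum_of_nonneg (fun k => by positivity) h.summable, h.tsum_eq,
    div_eq_mul_inv]

theorem measurable_cellCount (Δ : ℝ) (j : ℕ) : Measurable fun t : ℕ → ℝ => cellCount Δ t j := by
  have hset : ∀ i : ℕ, MeasurableSet {t : ℕ → ℝ | ⌊t i / Δ⌋₊ = j} := by
    intro i
    have hm : Measurable fun t : ℕ → ℝ => t i / Δ := by fun_prop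
    exact (Nat.measurable_floor.comp hm) (measurableSet_singleton j)
  -- In `ℝ≥0∞` the count is a series of measurable indicators.
  have h1 : Measurable fun t : ℕ → ℝ => (cellCount Δ t j : ℝ≥0∞) := by
    have : (fun t : ℕ → ℝ => (cellCount Δ t j : ℝ≥0∞)) = fun t => ∑' i : ℕ,
        {t : ℕ → ℝ | ⌊t i / Δ⌋₊ = j}.indicator (fun _ => 1) t := by
      ext t
      rw [cellCount, ← ENNReal.tsum_set_one, tsum_subtype {i | ⌊t i / Δ⌋₊ = j} (fun _ => (1 : ℝ≥0∞))]
      refine tsum_congr fun i => ?_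
      simp [indicator]
    rw [this]
    exact Measurable.tsum fun i => measurable_const.indicator (hset i)
  refine measurable_to_countable' fun n => ?_
  have : (fun t : ℕ → ℝ => cellCount Δ t j) ⁻¹' {n} =
      (fun t : ℕ → ℝ => (cellCount Δ t j : ℝ≥0∞)) ⁻¹' {(n : ℝ≥0∞)} := by
    ext t; simp
  rw [this]
  exact h1 (measurableSet_singleton _)

theorem measurableSet_firstCell (Δ : ℝ) (k : ℕ) : MeasurableSet {t | FirstCell Δ k t} := by
  have h1 : ∀ (j : ℕ) (n : ℕ∞), MeasurableSet {t : ℕ → ℝ | cellCount Δ t j = n} := fun j n =>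
    measurable_cellCount Δ j (measurableSet_singleton n)
  have : {t | FirstCell Δ k t} =
      (⋂ j ∈ Finset.range k, {t | cellCount Δ t j = 0}) ∩ {t | cellCount Δ t k = 1} := by
    ext t; simp [FirstCell]
  rw [this]
  exact (Finset.measurableSet_biInter _ fun j _ => h1 j 0).inter (h1 k 1)

theorem pairwise_disjoint_firstCell {Ω : Type*} (T : ℕ → Ω → ℝ) (Δ : ℝ) :
    Pairwise (Function.onFun Disjoint fun k => {ω | FirstCell Δ k (fun i => T i ω)}) := by
  have key : ∀ (k l : ℕ) (t : ℕ → ℝ), k < l → FirstCell Δ k t → FirstCell Δ l t → False := by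
    intro k l t hkl h1 h2
    have := h1.2.symm.trans (h2.1 k hkl)
    exact one_ne_zero this
  intro k l hkl
  refine Set.disjoint_left.2 fun ω h1 h2 => ?_
  rcases lt_or_gt_of_ne hkl with h | h
  · exact key k l _ h h1 h2
  · exact key l k _ h h2 h1

section UnitPoisson

variable {Ω : Type*} [MeasurableSpace Ω] {μ : Measure Ω}
  {T : ℕ → Ω → ℝ} {Δ : ℝ}

theorem IsUnitPoisson.measurable_pi (hT : IsUnitPoisson μ T) :
    Measurable fun ω i => T i ω := measurable_pi_lambda _ hT.measurable

theorem IsUnitPoisson.measurable_count (hT : IsUnitPoisson μ T) (j : ℕ) :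
    Measurable fun ω => cellCount Δ (fun i => T i ω) j :=
  (measurable_cellCount Δ j).comp hT.measurable_pi

theorem IsUnitPoisson.count_ne_top [IsProbabilityMeasure μ] (hT : IsUnitPoisson μ T)
    (hΔ : 0 < Δ) : ∀ᵐ ω ∂μ, ∀ j, cellCount Δ (fun i => T i ω) j ≠ ⊤ := by
  rw [ae_all_iff]
  intro j
  have hm := hT.measurable_count (Δ := Δ) j
  have h1 : μ (⋃ k : ℕ, {ω | cellCount Δ (fun i => T i ω) j = k}) = 1 := by
    rw [measure_iUnion]
    · simp_rw [hT.count_law Δ hΔ j]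
      have := lintegral_countable' (μ := poissonMeasure Δ.toNNReal) (fun _ => 1)
      simpa using this.symm
    · intro k l hkl
      refine Set.disjoint_left.2 fun ω h1 h2 => hkl ?_
      have h3 : ((k : ℕ) : ℕ∞) = l := (show cellCount Δ _ j = k from h1).symm.trans h2
      exact_mod_cast h3
    · exact fun k => hm (measurableSet_singleton _)
  have h2 := (prob_compl_eq_zero_iff
    (MeasurableSet.iUnion fun k : ℕ => hm (measurableSet_singleton (k : ℕ∞)))).2 h1
  rw [ae_iff]
  refine measure_mono_null (fun ω hω => ?_) h2
  simp only [mem_ofPred_eq, not_not] at hω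
  simp only [mem_compl_iff, mem_iUnion, not_exists]
  intro k hk
  have hk' : cellCount Δ (fun i => T i ω) j = k := hk
  rw [hω] at hk'
  exact absurd hk'.symm (ENat.natCast_ne_top k)

theorem IsUnitPoisson.lintegral_count [IsProbabilityMeasure μ] (hT : IsUnitPoisson μ T)
    (hΔ : 0 < Δ) (j : ℕ) (g : ℕ → ℝ≥0∞) :
    ∫⁻ ω, g (cellCount Δ (fun i => T i ω) j).toNat ∂μ =
      ∫⁻ n, g n ∂poissonMeasure Δ.toNNReal := by
  have hm : Measurable fun ω => (cellCount Δ (fun i => T i ω) j).toNat :=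
    (Measurable.of_discrete (f := ENat.toNat)).comp (hT.measurable_count j)
  have hmap : μ.map (fun ω => (cellCount Δ (fun i => T i ω) j).toNat) =
      poissonMeasure Δ.toNNReal := by
    refine Measure.ext_of_singleton fun k => ?_
    rw [Measure.map_apply hm (measurableSet_singleton k), ← hT.count_law Δ hΔ j k]
    refine measure_congr ?_
    filter_upwards [hT.count_ne_top hΔ] with ω hω
    have h1 := ENat.natCast_toNat (hω j)
    refine propext ⟨fun h => ?_, fun h => ?_⟩
    · have h' : (cellCount Δ (fun i => T i ω) j).toNat = k := h
      rw [h'] at h1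
      exact h1.symm
    · have h' : cellCount Δ (fun i => T i ω) j = k := h
      change (cellCount Δ (fun i => T i ω) j).toNat = k
      rw [h', ENat.toNat_natCast]
  rw [← hmap, lintegral_map Measurable.of_discrete hm]

/-- Event and integrand together are a product of functions of separate cell counts, so independence
applies: `e^{-Δ}` for each empty cell, `Δ e^{-Δ}` for cell `k`, and the Poisson generating function
at `b l` for the later cells. -/
theorem IsUnitPoisson.setLIntegral_firstCell [IsProbabilityMeasure μ] (hT : IsUnitPoisson μ T)
    (hΔ : 0 < Δ) (k m : ℕ) {b : ℕ → ℝ} (hb : ∀ l, 0 ≤ b l) :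
    ∫⁻ ω in {ω | FirstCell Δ k (fun i => T i ω)}, ∏ l ∈ Finset.range m,
        ENNReal.ofReal (b l) ^ (cellCount Δ (fun i => T i ω) (k + 1 + l)).toNat ∂μ =
      ENNReal.ofReal (Real.exp (-Δ) ^ k * (Δ * Real.exp (-Δ)) *
        Real.exp (-(Δ * ∑ l ∈ Finset.range m, (1 - b l)))) := by
  set g : ℕ → ℕ → ℝ≥0∞ := fun j n =>
    if j < k then (if n = 0 then 1 else 0) else if j = k then (if n = 1 then 1 else 0)
    else ENNReal.ofReal (b (j - (k + 1))) ^ n with hg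
  have hE : MeasurableSet {ω | FirstCell Δ k (fun i => T i ω)} :=
    hT.measurable_pi (measurableSet_firstCell Δ k)
  have hprod : ∀ᵐ ω ∂μ, {ω | FirstCell Δ k (fun i => T i ω)}.indicator (fun ω =>
      ∏ l ∈ Finset.range m,
        ENNReal.ofReal (b l) ^ (cellCount Δ (fun i => T i ω) (k + 1 + l)).toNat) ω =
      ∏ j ∈ Finset.range (k + 1 + m), g j (cellCount Δ (fun i => T i ω) j).toNat := by
    filter_upwards [hT.count_ne_top hΔ] with ω hω
    rw [Finset.prod_range_add, Finset.prod_range_succ]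
    have h3 : ∀ l, g (k + 1 + l) (cellCount Δ (fun i => T i ω) (k + 1 + l)).toNat =
        ENNReal.ofReal (b l) ^ (cellCount Δ (fun i => T i ω) (k + 1 + l)).toNat := by
      intro l
      simp only [hg]
      rw [if_neg (by omega), if_neg (by omega), Nat.add_sub_cancel_left]
    simp_rw [h3]
    by_cases hF : FirstCell Δ k (fun i => T i ω)
    · rw [indicator_of_mem (show ω ∈ {ω | FirstCell Δ k (fun i => T i ω)} from hF)]
      have h1 : ∏ j ∈ Finset.range k, g j (cellCount Δ (fun i => T i ω) j).toNat = 1 := by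
        refine Finset.prod_eq_one fun j hj => ?_
        have hj' := Finset.mem_range.1 hj
        simp [hg, hj', hF.1 j hj']
      have h2 : g k (cellCount Δ (fun i => T i ω) k).toNat = 1 := by
        simp [hg, hF.2]
      rw [h1, h2, one_mul, one_mul]
    · rw [indicator_of_notMem (show ω ∉ {ω | FirstCell Δ k (fun i => T i ω)} from hF)]
      symm
      by_cases h2 : cellCount Δ (fun i => T i ω) k = 1
      · obtain ⟨j, hj, hj0⟩ : ∃ j < k, cellCount Δ (fun i => T i ω) j ≠ 0 := by
          by_contra hcon
          push Not at hcon
          exact hF ⟨hcon, h2⟩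
        rw [Finset.prod_eq_zero (Finset.mem_range.2 hj), zero_mul, zero_mul]
        simp [hg, hj, hj0, hω j]
      · have : g k (cellCount Δ (fun i => T i ω) k).toNat = 0 := by
          have : (cellCount Δ (fun i => T i ω) k).toNat ≠ 1 := by
            intro h; apply h2
            rw [← ENat.natCast_toNat (hω k), h]; rfl
          simp [hg, this]
        rw [this, mul_zero, zero_mul]
  have hgm : ∀ j, Measurable fun c : ℕ∞ => g j c.toNat := fun j => Measurable.of_discrete
  rw [← lintegral_indicator hE, lintegral_congr_ae hprod,
    lintegral_prod_eq_prod_lintegral_of_indepFun _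
      (fun j ω => g j (cellCount Δ (fun i => T i ω) j).toNat)
      ((hT.count_indep Δ hΔ).comp _ hgm) (fun j => (hgm j).comp (hT.measurable_count j))]
  simp_rw [hT.lintegral_count hΔ]
  have hpt : ∀ n : ℕ, ∫⁻ i, (if i = n then (1 : ℝ≥0∞) else 0) ∂poissonMeasure Δ.toNNReal =
      ENNReal.ofReal (Real.exp (-Δ) * Δ ^ n / n !) := by
    intro n
    have h1 := lintegral_indicator_one (μ := poissonMeasure Δ.toNNReal)
      (measurableSet_singleton n)
    rw [poissonMeasure_singleton, Real.coe_toNNReal _ hΔ.le] at h1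
    rw [← h1]
    refine lintegral_congr fun i => ?_
    by_cases hi : i = n <;> simp [hi]
  have e1 : ∀ j ∈ Finset.range k, ∫⁻ n, g j n ∂poissonMeasure Δ.toNNReal =
      ENNReal.ofReal (Real.exp (-Δ)) := by
    intro j hj
    have := hpt 0
    simp only [pow_zero, mul_one, Nat.factorial_zero, Nat.cast_one, div_one] at this
    rw [← this]
    simp [hg, Finset.mem_range.1 hj]
  have e2 : ∫⁻ n, g k n ∂poissonMeasure Δ.toNNReal = ENNReal.ofReal (Δ * Real.exp (-Δ)) := by
    have := hpt 1
    simp only [pow_one, Nat.factorial_one, Nat.cast_one, div_one] at this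
    rw [mul_comm Δ, ← this]
    simp [hg]
  have e3 : ∀ l ∈ Finset.range m, ∫⁻ n, g (k + 1 + l) n ∂poissonMeasure Δ.toNNReal =
      ENNReal.ofReal (Real.exp (-(Δ * (1 - b l)))) := by
    intro l _
    rw [← lintegral_poissonMeasure_pow hΔ.le (hb l)]
    refine lintegral_congr fun n => ?_
    simp only [hg]
    rw [if_neg (by omega), if_neg (by omega), Nat.add_sub_cancel_left]
  rw [Finset.prod_range_add, Finset.prod_range_succ, Finset.prod_congr rfl e1, e2,
    Finset.prod_congr rfl e3, Finset.prod_const, Finset.card_range,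
    ← ENNReal.ofReal_prod_of_nonneg (fun l _ => (Real.exp_pos _).le), ← Real.exp_sum,
    ← ENNReal.ofReal_pow (Real.exp_pos _).le, ← ENNReal.ofReal_mul (by positivity),
    ← ENNReal.ofReal_mul (by positivity), Finset.mul_sum, Finset.sum_neg_distrib]

variable [IsProbabilityMeasure μ] {f : ℝ → ℝ} {c : ℝ}

/-- The events for different `k` are disjoint, and the bounds on them form a geometric series of
ratio `e^{-Δ (1 + c)}`; the rest of the space is dropped. -/
theorem IsUnitPoisson.le_lintegral_ratioProd (hT : IsUnitPoisson μ T) (hΔ : 0 < Δ) (hc : 0 ≤ c)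
    (hf : AntitoneOn f (Ici 0)) (hf0 : ∀ x, 0 ≤ x → 0 ≤ f x) (hf1 : ∀ x, 0 ≤ x → f x ≤ 1)
    (hsum : ∀ k m : ℕ, ∑ l ∈ Finset.range m, (1 - f ((k + 1) / (k + 1 + l))) ≤ 1 + (k + 1) * c) :
    ENNReal.ofReal (Δ * Real.exp (-Δ) * Real.exp (-(Δ * (1 + c))) /
      (1 - Real.exp (-(Δ * (1 + c))))) ≤ ∫⁻ ω, ratioProd f (fun i => T i ω) ∂μ := by
  have hE : ∀ k, MeasurableSet {ω | FirstCell Δ k (fun i => T i ω)} := fun k =>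
    hT.measurable_pi (measurableSet_firstCell Δ k)
  have hr1 : Real.exp (-(Δ * (1 + c))) < 1 := Real.exp_lt_one_iff.2 (by nlinarith)
  rw [← tsum_ofReal_geometric (by positivity) (Real.exp_pos _).le hr1]
  calc _ ≤ ∑' k, ∫⁻ ω in {ω | FirstCell Δ k (fun i => T i ω)},
        ratioProd f (fun i => T i ω) ∂μ := by
        refine ENNReal.tsum_le_tsum fun k => ?_
        have hb : ∀ l : ℕ, 0 ≤ f ((k + 1) / (k + 1 + l)) := fun l => hf0 _ (by positivity)
        have hmono : ∫⁻ ω in {ω | FirstCell Δ k (fun i => T i ω)}, ⨅ m : ℕ,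
            ∏ l ∈ Finset.range m, ENNReal.ofReal (f ((k + 1) / (k + 1 + l))) ^
              (cellCount Δ (fun i => T i ω) (k + 1 + l)).toNat ∂μ ≤
            ∫⁻ ω in {ω | FirstCell Δ k (fun i => T i ω)}, ratioProd f (fun i => T i ω) ∂μ := by
          refine lintegral_mono_ae ?_
          filter_upwards [ae_restrict_mem (hE k), ae_restrict_of_ae (hT.count_ne_top hΔ)]
            with ω h1 h2
          exact le_ratioProd_of_firstCell hf hf1 hΔ (fun i => hT.nonneg i ω) h2 h1
        refine le_trans ?_ hmono
        -- The products decrease in `m`, so the infimum comes out of the integral; `m = 0` supplies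
        -- finiteness.
        rw [lintegral_iInf]
        · refine le_iInf fun m => ?_
          rw [hT.setLIntegral_firstCell hΔ k m hb]
          refine ENNReal.ofReal_le_ofReal ?_
          have e1 : Δ * Real.exp (-Δ) * Real.exp (-(Δ * (1 + c))) *
              Real.exp (-(Δ * (1 + c))) ^ k = Real.exp (-Δ) ^ k * (Δ * Real.exp (-Δ)) *
                Real.exp (-(Δ * (1 + (k + 1) * c))) := by
            rw [← Real.exp_nat_mul, ← Real.exp_nat_mul]
            have : ∀ x y z : ℝ, Real.exp x * (Δ * Real.exp y) * Real.exp z =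
              Δ * Real.exp (x + y + z) := by
              intro x y z; rw [Real.exp_add, Real.exp_add]; ring
            rw [this, mul_assoc, mul_assoc, ← Real.exp_add, ← Real.exp_add]
            congr 2; ring
          rw [e1]
          have := hsum k m
          gcongr
        · intro m
          exact Finset.measurable_prod _ fun l _ =>
            (Measurable.of_discrete (f := fun n : ℕ∞ =>
              ENNReal.ofReal (f ((k + 1) / (k + 1 + l))) ^ n.toNat)).comp
              (hT.measurable_count _)
        · intro m n hmn ω
          refine Finset.prod_le_prod_of_subset_of_le_one' (Finset.range_mono hmn) fun l _ _ => ?_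
          exact pow_le_one' (ENNReal.ofReal_le_one.2 (hf1 _ (by positivity))) _
        · rw [hT.setLIntegral_firstCell hΔ k 0 hb]
          exact ENNReal.ofReal_ne_top
    _ = ∫⁻ ω in ⋃ k, {ω | FirstCell Δ k (fun i => T i ω)}, ratioProd f (fun i => T i ω) ∂μ :=
        (lintegral_iUnion hE (pairwise_disjoint_firstCell T Δ) _).symm
    _ ≤ _ := setLIntegral_le_lintegral _ _

/-- Outside the disjoint events the product is bounded by `1`. Their complement has probability `1 -
Δ e^{-Δ} / (1 - e^{-Δ})`, which vanishes as `Δ → 0`. -/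
theorem IsUnitPoisson.lintegral_ratioProd_le (hT : IsUnitPoisson μ T) (hΔ : 0 < Δ) (hc : 0 ≤ c)
    (hf : AntitoneOn f (Ici 0)) (hf0 : ∀ x, 0 ≤ x → 0 ≤ f x)
    (hsum : ∀ k : ℕ, ∃ m, k * c - 3 ≤ ∑ l ∈ Finset.range m, (1 - f (k / (k + 2 + l)))) :
    ∫⁻ ω, ratioProd f (fun i => T i ω) ∂μ ≤
      ENNReal.ofReal (Δ * Real.exp (-Δ) * Real.exp (3 * Δ) / (1 - Real.exp (-(Δ * (1 + c)))) +
        (1 - Δ * Real.exp (-Δ) / (1 - Real.exp (-Δ)))) := by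
  have hE : ∀ k, MeasurableSet {ω | FirstCell Δ k (fun i => T i ω)} := fun k =>
    hT.measurable_pi (measurableSet_firstCell Δ k)
  have hr1 : Real.exp (-(Δ * (1 + c))) < 1 := Real.exp_lt_one_iff.2 (by nlinarith)
  have hr2 : Real.exp (-Δ) < 1 := Real.exp_lt_one_iff.2 (by linarith)
  have hdisj := pairwise_disjoint_firstCell T Δ
  have hU := MeasurableSet.iUnion hE
  have hμU : μ (⋃ k, {ω | FirstCell Δ k (fun i => T i ω)}) =
      ENNReal.ofReal (Δ * Real.exp (-Δ) / (1 - Real.exp (-Δ))) := by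
    rw [measure_iUnion hdisj hE, ← tsum_ofReal_geometric (by positivity) (Real.exp_pos _).le hr2]
    refine tsum_congr fun k => ?_
    have := hT.setLIntegral_firstCell hΔ k 0 (b := fun _ => 0) (fun _ => le_rfl)
    simp only [Finset.range_zero, Finset.prod_empty, lintegral_const, one_mul,
      Measure.restrict_apply, MeasurableSet.univ, univ_inter, Finset.sum_empty, mul_zero,
      neg_zero, Real.exp_zero, mul_one] at this
    rw [this, mul_comm]
  have hle1 : Δ * Real.exp (-Δ) / (1 - Real.exp (-Δ)) ≤ 1 := by
    have : μ (⋃ k, {ω | FirstCell Δ k (fun i => T i ω)}) ≤ 1 := prob_le_one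
    rw [hμU] at this
    exact ENNReal.ofReal_le_one.1 this
  have h1 : 0 ≤ Δ * Real.exp (-Δ) / (1 - Real.exp (-Δ)) :=
    div_nonneg (by positivity) (by linarith)
  rw [ENNReal.ofReal_add (div_nonneg (by positivity) (by linarith)) (by linarith),
    ENNReal.ofReal_sub _ h1, ENNReal.ofReal_one, ← hμU, ← prob_compl_eq_one_sub hU,
    ← lintegral_add_compl _ hU]
  refine add_le_add ?_ ?_
  · rw [lintegral_iUnion hE hdisj,
      ← tsum_ofReal_geometric (by positivity) (Real.exp_pos _).le hr1]
    refine ENNReal.tsum_le_tsum fun k => ?_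
    obtain ⟨m, hm⟩ := hsum k
    have hmono : ∫⁻ ω in {ω | FirstCell Δ k (fun i => T i ω)}, ratioProd f (fun i => T i ω) ∂μ ≤
        ∫⁻ ω in {ω | FirstCell Δ k (fun i => T i ω)},
          ∏ l ∈ Finset.range m, ENNReal.ofReal (f (k / (k + 2 + l))) ^
            (cellCount Δ (fun i => T i ω) (k + 1 + l)).toNat ∂μ := by
      refine lintegral_mono_ae ?_
      filter_upwards [ae_restrict_mem (hE k), ae_restrict_of_ae (hT.count_ne_top hΔ)]
        with ω h1 h2
      exact ratioProd_le_of_firstCell hf hΔ (fun i => hT.nonneg i ω) h2 h1 m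
    refine hmono.trans ?_
    rw [hT.setLIntegral_firstCell hΔ k m (b := fun l => f (k / (k + 2 + l)))
      (fun l => hf0 _ (by positivity))]
    refine ENNReal.ofReal_le_ofReal ?_
    have e1 : Δ * Real.exp (-Δ) * Real.exp (3 * Δ) * Real.exp (-(Δ * (1 + c))) ^ k =
        Real.exp (-Δ) ^ k * (Δ * Real.exp (-Δ)) * Real.exp (-(Δ * (k * c - 3))) := by
      rw [← Real.exp_nat_mul, ← Real.exp_nat_mul]
      have : ∀ x y z : ℝ, Real.exp x * (Δ * Real.exp y) * Real.exp z =
          Δ * Real.exp (x + y + z) := by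
        intro x y z; rw [Real.exp_add, Real.exp_add]; ring
      rw [this, mul_assoc, mul_assoc, ← Real.exp_add, ← Real.exp_add]
      congr 2; ring
    rw [e1]
    gcongr
  · calc _ ≤ ∫⁻ _ in (⋃ k, {ω | FirstCell Δ k (fun i => T i ω)})ᶜ, 1 ∂μ :=
          lintegral_mono fun ω => ratioProd_le_one _ _
      _ = _ := by simp

/-- The inverse of a difference quotient: `1 - e^{-Δ a}` has derivative `a` at `0`. -/
theorem tendsto_mul_inv_one_sub_exp {a : ℝ} (ha : 0 < a) :
    Tendsto (fun Δ : ℝ => Δ / (1 - Real.exp (-(Δ * a)))) (𝓝[>] 0) (𝓝 (1 / a)) := by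
  have hd : HasDerivAt (fun Δ : ℝ => 1 - Real.exp (-(Δ * a))) a 0 := by
    have := (((hasDerivAt_id (0 : ℝ)).mul_const a).neg.exp).const_sub 1
    simpa using this
  have h1 := (hasDerivAt_iff_tendsto_slope_zero.1 hd).mono_left
    (nhdsWithin_mono 0 (fun x (hx : 0 < x) => hx.ne') : 𝓝[>] (0 : ℝ) ≤ 𝓝[≠] 0)
  have h2 := h1.inv₀ ha.ne'
  rw [one_div]
  refine h2.congr fun Δ => ?_
  simp [div_eq_mul_inv, mul_comm]

/-- The limit is `∫ e^{-t} e^{-ct} dt`, with `t` the smallest point. The additive errors `1` and `3`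
in the hypotheses are harmless: they cost factors `e^{-Δ}` and `e^{3Δ}`, which tend to `1`. -/
theorem IsUnitPoisson.lintegral_ratioProd (hT : IsUnitPoisson μ T) (hc : 0 ≤ c)
    (hf : AntitoneOn f (Ici 0)) (hf0 : ∀ x, 0 ≤ x → 0 ≤ f x) (hf1 : ∀ x, 0 ≤ x → f x ≤ 1)
    (hlow : ∀ k m : ℕ, ∑ l ∈ Finset.range m, (1 - f ((k + 1) / (k + 1 + l))) ≤ 1 + (k + 1) * c)
    (hup : ∀ k : ℕ, ∃ m, k * c - 3 ≤ ∑ l ∈ Finset.range m, (1 - f (k / (k + 2 + l)))) :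
    ∫⁻ ω, ratioProd f (fun i => T i ω) ∂μ = ENNReal.ofReal (1 / (1 + c)) := by
  have hexp : ∀ a : ℝ, Tendsto (fun Δ : ℝ => Real.exp (a * Δ)) (𝓝[>] 0) (𝓝 1) := by
    intro a
    have : Continuous fun Δ : ℝ => Real.exp (a * Δ) := by fun_prop
    have h := this.tendsto 0
    rw [mul_zero, Real.exp_zero] at h
    exact h.mono_left nhdsWithin_le_nhds
  have hA := tendsto_mul_inv_one_sub_exp (show 0 < 1 + c by linarith)
  have hB := tendsto_mul_inv_one_sub_exp one_pos
  refine le_antisymm ?_ ?_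
  · have h : Tendsto (fun Δ : ℝ => Δ / (1 - Real.exp (-(Δ * (1 + c)))) * Real.exp (-1 * Δ) *
        Real.exp (3 * Δ) + (1 - Δ / (1 - Real.exp (-(Δ * 1))) * Real.exp (-1 * Δ))) (𝓝[>] 0)
        (𝓝 (1 / (1 + c) * 1 * 1 + (1 - 1 / 1 * 1))) :=
      ((hA.mul (hexp _)).mul (hexp _)).add ((hB.mul (hexp _)).const_sub 1)
    rw [show 1 / (1 + c) * 1 * 1 + (1 - 1 / 1 * 1) = 1 / (1 + c) by ring] at h
    refine ge_of_tendsto (ENNReal.tendsto_ofReal h) ?_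
    filter_upwards [self_mem_nhdsWithin] with Δ hΔ
    refine (hT.lintegral_ratioProd_le hΔ hc hf hf0 hup).trans (le_of_eq ?_)
    congr 1
    simp only [mul_one, neg_mul, one_mul]
    ring
  · have h : Tendsto (fun Δ : ℝ => Δ / (1 - Real.exp (-(Δ * (1 + c)))) * Real.exp (-1 * Δ) *
        Real.exp (-(1 + c) * Δ)) (𝓝[>] 0) (𝓝 (1 / (1 + c) * 1 * 1)) :=
      (hA.mul (hexp _)).mul (hexp _)
    rw [mul_one, mul_one] at h
    refine le_of_tendsto (ENNReal.tendsto_ofReal h) ?_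
    filter_upwards [self_mem_nhdsWithin] with Δ hΔ
    refine le_trans (le_of_eq ?_) (hT.le_lintegral_ratioProd hΔ hc hf hf0 hf1 hlow)
    congr 1
    rw [show -(1 + c) * Δ = -(Δ * (1 + c)) by ring]
    simp only [neg_mul, one_mul]
    ring

end UnitPoisson

end EdgeCaching

namespace EdgeCaching

/-! ### Comparison of sums over cells with the interference integral -/

section Riemann

variable {δ θ p : ℝ}

/-- The Laplace transform of a thinned exponential variable at `θ x ^ δ`. -/
noncomputable def thinnedLaplace (p δ θ x : ℝ) : ℝ := 1 - p * (θ * x ^ δ / (1 + θ * x ^ δ))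

theorem div_one_add_mem_Icc {x : ℝ} (hx : 0 ≤ x) : 0 ≤ x / (1 + x) ∧ x / (1 + x) ≤ 1 :=
  ⟨by positivity, by rw [div_le_one (by positivity)]; linarith⟩

theorem thinnedLaplace_mem_Icc (hp0 : 0 ≤ p) (hp1 : p ≤ 1) (hθ : 0 ≤ θ) {x : ℝ} (hx : 0 ≤ x) :
    0 ≤ thinnedLaplace p δ θ x ∧ thinnedLaplace p δ θ x ≤ 1 := by
  obtain ⟨h1, h2⟩ := div_one_add_mem_Icc (show 0 ≤ θ * x ^ δ by positivity)
  unfold thinnedLaplace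
  constructor <;> nlinarith

theorem antitoneOn_thinnedLaplace (hp0 : 0 ≤ p) (hδ : 0 ≤ δ) (hθ : 0 ≤ θ) :
    AntitoneOn (thinnedLaplace p δ θ) (Ici 0) := by
  intro x hx y hy hxy
  have hx0 : 0 ≤ x := hx
  have hy0 : 0 ≤ y := hy
  have h1 : x ^ δ ≤ y ^ δ := Real.rpow_le_rpow hx0 hxy hδ
  have h2 : θ * x ^ δ / (1 + θ * x ^ δ) ≤ θ * y ^ δ / (1 + θ * y ^ δ) := by
    have h3 : θ * x ^ δ ≤ θ * y ^ δ := by gcongr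
    rw [div_le_div_iff₀ (by positivity) (by positivity)]
    nlinarith
  unfold thinnedLaplace
  nlinarith

theorem one_sub_thinnedLaplace_div {a v : ℝ} (ha : 0 < a) (hv : 0 < v) (hθ : 0 ≤ θ) :
    1 - thinnedLaplace p δ θ (a / v) = p * (θ / ((a⁻¹ * v) ^ δ + θ)) := by
  have h1 : 0 < a ^ δ := Real.rpow_pos_of_pos ha _
  have h2 : 0 < v ^ δ := Real.rpow_pos_of_pos hv _
  rw [thinnedLaplace, sub_sub_cancel, Real.div_rpow ha.le hv.le,
    Real.mul_rpow (inv_nonneg.2 ha.le) hv.le, Real.inv_rpow ha.le]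
  have h3 : 0 < v ^ δ + θ * a ^ δ := by positivity
  congr 1
  have h4 : 1 + θ * (a ^ δ / v ^ δ) = (v ^ δ + θ * a ^ δ) / v ^ δ := by field_simp
  have h5 : (a ^ δ)⁻¹ * v ^ δ + θ = (v ^ δ + θ * a ^ δ) / a ^ δ := by field_simp
  rw [h4, h5]
  field_simp

theorem antitoneOn_interf (hδ : 0 ≤ δ) (hθ : 0 ≤ θ) {a : ℝ} (ha : 0 < a) :
    AntitoneOn (fun v : ℝ => θ / ((a⁻¹ * v) ^ δ + θ)) (Ici a) := by
  intro x hx y hy hxy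
  have hx0 : 0 < x := ha.trans_le hx
  have h1 : (a⁻¹ * x) ^ δ ≤ (a⁻¹ * y) ^ δ := by gcongr
  have : 0 < (a⁻¹ * x) ^ δ := by positivity
  simp only
  gcongr

theorem integrableOn_interf_scaled (hδ : 1 < δ) (hθ : 0 ≤ θ) {a : ℝ} (ha : 0 < a) :
    IntegrableOn (fun v : ℝ => θ / ((a⁻¹ * v) ^ δ + θ)) (Ioi a) := by
  have h := (integrableOn_Ioi_comp_mul_left_iff (fun v : ℝ => θ / (v ^ δ + θ)) a
    (inv_pos.2 ha)).2
  rw [inv_mul_cancel₀ ha.ne'] at h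
  exact h (integrableOn_interf hδ (by linarith))

theorem integral_interf_scaled {a : ℝ} (ha : 0 < a) :
    ∫ v in Ioi a, θ / ((a⁻¹ * v) ^ δ + θ) = a * interfExponent δ θ := by
  have h := integral_comp_mul_left_Ioi (fun v : ℝ => θ / (v ^ δ + θ)) a (inv_pos.2 ha)
  rw [inv_mul_cancel₀ ha.ne', inv_inv, smul_eq_mul] at h
  exact h

theorem interf_scaled_le_one (hθ : 0 ≤ θ) {a v : ℝ} (ha : 0 < a) (hv : 0 < v) :
    0 ≤ θ / ((a⁻¹ * v) ^ δ + θ) ∧ θ / ((a⁻¹ * v) ^ δ + θ) ≤ 1 := by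
  have : 0 < (a⁻¹ * v) ^ δ := by positivity
  exact ⟨by positivity, by rw [div_le_one (by positivity)]; linarith⟩

theorem interfExponent_nonneg (hθ : 0 ≤ θ) : 0 ≤ interfExponent δ θ := by
  refine setIntegral_nonneg measurableSet_Ioi fun v hv => ?_
  have : (0 : ℝ) < v := zero_lt_one.trans hv
  positivity

/-- An antitone summand is compared with its integral over `(k + 1, ∞)`, which rescales to `(k + 1)
G(θ)`. -/
theorem sum_one_sub_thinnedLaplace_le (hp0 : 0 ≤ p) (hp1 : p ≤ 1) (hδ : 1 < δ) (hθ : 0 ≤ θ)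
    (k m : ℕ) : ∑ l ∈ Finset.range m, (1 - thinnedLaplace p δ θ ((k + 1) / (k + 1 + l))) ≤
      1 + (k + 1) * (p * interfExponent δ θ) := by
  have ha : (0 : ℝ) < k + 1 := by positivity
  have hG := interfExponent_nonneg (δ := δ) hθ
  have hterm : ∀ l : ℕ, 1 - thinnedLaplace p δ θ ((k + 1) / (k + 1 + l)) =
      p * (θ / ((((k : ℝ) + 1)⁻¹ * (k + 1 + l)) ^ δ + θ)) := fun l =>
    one_sub_thinnedLaplace_div ha (by positivity) hθ
  simp_rw [hterm]
  rw [← Finset.mul_sum]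
  have hS : ∑ l ∈ Finset.range m, θ / ((((k : ℝ) + 1)⁻¹ * (k + 1 + l)) ^ δ + θ) ≤
      1 + (k + 1) * interfExponent δ θ := by
    cases m with
    | zero => simp only [Finset.range_zero, Finset.sum_empty]; positivity
    | succ m =>
      -- The term `l = 0` has no interval to its left in the integration range; it is bounded by `1`
      -- on its own.
      rw [Finset.sum_range_succ', add_comm]
      refine add_le_add ?_ ?_
      · exact (interf_scaled_le_one hθ ha (by positivity)).2
      · have h1 := AntitoneOn.sum_le_integral (x₀ := (k : ℝ) + 1) (a := m)
          ((antitoneOn_interf (by linarith : 0 ≤ δ) hθ ha).mono Icc_subset_Ici_self)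
        refine h1.trans ?_
        rw [intervalIntegral.integral_of_le (by linarith [(Nat.cast_nonneg m : (0 : ℝ) ≤ m)]),
          ← integral_interf_scaled ha]
        refine setIntegral_mono_set (integrableOn_interf_scaled hδ hθ ha) ?_
          (ae_of_all _ Ioc_subset_Ioi_self)
        filter_upwards [ae_restrict_mem measurableSet_Ioi] with v hv
        exact (interf_scaled_le_one hθ ha (ha.trans hv)).1
  nlinarith

theorem exists_le_sum_one_sub_thinnedLaplace (hp0 : 0 ≤ p) (hp1 : p ≤ 1) (hδ : 1 < δ)
    (hθ : 0 ≤ θ) (k : ℕ) : ∃ m : ℕ, k * (p * interfExponent δ θ) - 3 ≤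
      ∑ l ∈ Finset.range m, (1 - thinnedLaplace p δ θ (k / (k + 2 + l))) := by
  rcases Nat.eq_zero_or_pos k with rfl | hk
  -- For `k = 0` the left side is `-3`, so the empty sum suffices; rescaling by `k⁻¹` needs `k > 0`.
  · exact ⟨0, by simp⟩
  have ha : (0 : ℝ) < k := by exact_mod_cast hk
  have hterm : ∀ l : ℕ, 1 - thinnedLaplace p δ θ (k / (k + 2 + l)) =
      p * (θ / (((k : ℝ)⁻¹ * (k + 2 + l)) ^ δ + θ)) := fun l =>
    one_sub_thinnedLaplace_div ha (by positivity) hθ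
  simp_rw [hterm, ← Finset.mul_sum]
  have hint := integrableOn_interf_scaled hδ hθ ha
  have hint2 : IntegrableOn (fun v : ℝ => θ / (((k : ℝ)⁻¹ * v) ^ δ + θ)) (Ioi ((k : ℝ) + 2)) :=
    hint.mono_set (Ioi_subset_Ioi (by linarith))
  have hlim := intervalIntegral_tendsto_integral_Ioi ((k : ℝ) + 2) hint2
    (tendsto_atTop_add_const_left _ ((k : ℝ) + 2) tendsto_natCast_atTop_atTop)
  have hsplit : ∫ v in Ioi (k : ℝ), θ / (((k : ℝ)⁻¹ * v) ^ δ + θ) =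
      (∫ v in Ioc (k : ℝ) (k + 2), θ / (((k : ℝ)⁻¹ * v) ^ δ + θ)) +
        ∫ v in Ioi ((k : ℝ) + 2), θ / (((k : ℝ)⁻¹ * v) ^ δ + θ) := by
    rw [← setIntegral_union (Ioc_disjoint_Ioi le_rfl) measurableSet_Ioi
      (hint.mono_set Ioc_subset_Ioi_self) hint2, Ioc_union_Ioi_eq_Ioi (by linarith)]
  have hIoc : ∫ v in Ioc (k : ℝ) (k + 2), θ / (((k : ℝ)⁻¹ * v) ^ δ + θ) ≤ 2 := by
    calc _ ≤ ∫ _ in Ioc (k : ℝ) (k + 2), (1 : ℝ) := by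
          refine setIntegral_mono_on (hint.mono_set Ioc_subset_Ioi_self) (by simp)
            measurableSet_Ioc fun v hv => ?_
          exact (interf_scaled_le_one hθ ha (ha.trans hv.1)).2
      _ = 2 := by
        rw [setIntegral_const, measureReal_def, Real.volume_Ioc]
        simp
  rw [integral_interf_scaled ha] at hsplit
  -- Of the loss `3`, starting at `k + 2` instead of `k` costs at most `2`; the remaining `1` is
  -- slack for truncating the integral at a finite `m`.
  have hlt : k * interfExponent δ θ - 3 <
      ∫ v in Ioi ((k : ℝ) + 2), θ / (((k : ℝ)⁻¹ * v) ^ δ + θ) := by linarith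
  obtain ⟨m, hm⟩ := (hlim.eventually (lt_mem_nhds hlt)).exists
  refine ⟨m, ?_⟩
  have h1 := AntitoneOn.integral_le_sum (x₀ := (k : ℝ) + 2) (a := m)
    ((antitoneOn_interf (by linarith : 0 ≤ δ) hθ ha).mono
      (Icc_subset_Ici_self.trans (Ici_subset_Ici.2 (by linarith : (k : ℝ) ≤ k + 2))))
  have h2 := hm.le.trans h1
  nlinarith

end Riemann

/-! ### The signal-to-interference ratio -/

/-- The interference, relative to the mean received power of the server and multiplied by the
threshold `θ`, when `t i` are the squared distances (up to a factor) and `y i` the marks. -/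
noncomputable def scaledInterf (δ θ : ℝ) (t : ℕ → ℝ) (y : ℕ → ℝ≥0∞) : ℝ≥0∞ :=
  weightedSum (argmin t) (fun i => θ * (t (argmin t) / t i) ^ δ) y

theorem scaledInterf_eq_mul {δ θ : ℝ} (hθ : 0 ≤ θ) (t : ℕ → ℝ) (y : ℕ → ℝ≥0∞) :
    scaledInterf δ θ t y = ENNReal.ofReal θ * scaledInterf δ 1 t y := by
  rw [scaledInterf, scaledInterf, weightedSum, weightedSum, ← ENNReal.tsum_mul_left]
  refine tsum_congr fun i => ?_
  split_ifs
  · simp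
  · rw [ENNReal.ofReal_mul hθ, one_mul, mul_assoc]

theorem measurable_argmin : Measurable argmin := by
  have hS : ∀ n : ℕ, MeasurableSet {t : ℕ → ℝ | ∀ i, t n ≤ t i} := by
    intro n
    have : {t : ℕ → ℝ | ∀ i, t n ≤ t i} = ⋂ i, {t | t n ≤ t i} := by ext; simp
    rw [this]
    exact MeasurableSet.iInter fun i =>
      measurableSet_le (measurable_pi_apply n) (measurable_pi_apply i)
  have hle : ∀ n : ℕ, MeasurableSet {t : ℕ → ℝ | argmin t ≤ n} := by
    intro n
    -- Sequences without a smallest entry belong here for every `n`, since `sInf ∅ = 0`.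
    have : {t : ℕ → ℝ | argmin t ≤ n} = (⋃ m ∈ Finset.range (n + 1), {t | ∀ i, t m ≤ t i}) ∪
        (⋃ m, {t | ∀ i, t m ≤ t i})ᶜ := by
      ext t
      simp only [mem_ofPred_eq, mem_union, mem_iUnion, mem_compl_iff, Finset.mem_range,
        exists_prop, not_exists]
      constructor
      · intro h
        by_cases hne : {n | ∀ i, t n ≤ t i}.Nonempty
        · exact Or.inl ⟨argmin t, Nat.lt_succ_of_le h, Nat.sInf_mem hne⟩
        · exact Or.inr fun m hm => hne ⟨m, hm⟩
      · rintro (⟨m, hm, hmin⟩ | h)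
        · exact (Nat.sInf_le (s := {n | ∀ i, t n ≤ t i}) hmin).trans (Nat.le_of_lt_succ hm)
        · have : {n | ∀ i, t n ≤ t i} = ∅ := eq_empty_of_forall_notMem h
          rw [argmin, this, Nat.sInf_empty]
          exact Nat.zero_le _
    rw [this]
    exact (Finset.measurableSet_biUnion _ fun m _ => hS m).union
      (MeasurableSet.iUnion hS).compl
  exact measurable_of_Iic hle

theorem measurable_eval_nat {Z X : Type*} [MeasurableSpace Z] [MeasurableSpace X]
    {n : Z → ℕ} {y : Z → ℕ → X} (hn : Measurable n) (hy : Measurable y) :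
    Measurable fun z => y z (n z) := by
  have h : Measurable fun q : (ℕ → X) × ℕ => q.1 q.2 :=
    measurable_from_prod_countable_left fun k => measurable_pi_apply k
  exact h.comp (hy.prodMk hn)

theorem measurable_scaledInterf (δ θ : ℝ) :
    Measurable fun z : (ℕ → ℝ) × (ℕ → ℝ≥0∞) => scaledInterf δ θ z.1 z.2 := by
  have hn : Measurable fun z : (ℕ → ℝ) × (ℕ → ℝ≥0∞) => argmin z.1 :=
    measurable_argmin.comp measurable_fst
  have ho : Measurable fun z : (ℕ → ℝ) × (ℕ → ℝ≥0∞) => z.1 (argmin z.1) :=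
    measurable_eval_nat hn measurable_fst
  refine Measurable.tsum fun i => Measurable.ite ?_ measurable_const ?_
  · exact hn (measurableSet_singleton i) |>.congr (by ext z; simp [eq_comm])
  · fun_prop

theorem measurable_scaledInterf_comp {Ω : Type*} [MeasurableSpace Ω] {μ : Measure Ω}
    {T : ℕ → Ω → ℝ} {v : ℕ → Ω → ℝ≥0∞} {p : ℝ} (hT : IsUnitPoisson μ T)
    (hv : ∀ i, IsThinnedExp μ p (v i)) (δ θ : ℝ) :
    Measurable fun ω => scaledInterf δ θ (fun i => T i ω) (fun i => v i ω) :=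
  (measurable_scaledInterf δ θ).comp
    (hT.measurable_pi.prodMk (measurable_pi_lambda _ fun i => (hv i).measurable))

/-! ### Laplace transform and tail event with random positions -/

section Fubini

variable {Ω X Y : Type*} [MeasurableSpace Ω] [MeasurableSpace X] [MeasurableSpace Y]
  {μ : Measure Ω} [IsProbabilityMeasure μ]

theorem lintegral_indepFun_eq {x : Ω → X} {y : Ω → Y} (hx : Measurable x) (hy : Measurable y)
    (hind : IndepFun x y μ) {F : X × Y → ℝ≥0∞} (hF : Measurable F) :
    ∫⁻ ω, F (x ω, y ω) ∂μ = ∫⁻ ω', ∫⁻ ω, F (x ω', y ω) ∂μ ∂μ := by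
  have : IsProbabilityMeasure (μ.map x) := Measure.isProbabilityMeasure_map hx.aemeasurable
  have : IsProbabilityMeasure (μ.map y) := Measure.isProbabilityMeasure_map hy.aemeasurable
  rw [← lintegral_map (f := F) hF (hx.prodMk hy),
    (indepFun_iff_map_prod_eq_prod_map_map hx.aemeasurable hy.aemeasurable).1 hind,
    lintegral_prod _ hF.aemeasurable, lintegral_map hF.lintegral_prod_right' hx]
  refine lintegral_congr fun ω' => ?_
  exact lintegral_map (hF.comp measurable_prodMk_left) hy

variable {T : ℕ → Ω → ℝ} {v : ℕ → Ω → ℝ≥0∞} {p δ θ : ℝ}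

/-- With the positions frozen, the transform over the marks is exactly `ratioProd` of
`thinnedLaplace`; the cell argument then applies with `c = p * interfExponent δ θ`. -/
theorem lintegral_expNeg_scaledInterf (hT : IsUnitPoisson μ T)
    (hv : ∀ i, IsThinnedExp μ p (v i)) (hvind : iIndepFun v μ)
    (hTv : IndepFun (fun ω i => T i ω) (fun ω i => v i ω) μ)
    (hp0 : 0 ≤ p) (hp1 : p ≤ 1) (hδ : 1 < δ) (hθ : 0 ≤ θ) :
    ∫⁻ ω, expNeg (scaledInterf δ θ (fun i => T i ω) (fun i => v i ω)) ∂μ =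
      ENNReal.ofReal (1 / (1 + p * interfExponent δ θ)) := by
  have hG := interfExponent_nonneg (δ := δ) hθ
  have hfub := lintegral_indepFun_eq hT.measurable_pi
    (measurable_pi_lambda _ fun i => (hv i).measurable) hTv
    (measurable_expNeg.comp (measurable_scaledInterf δ θ))
  simp only [Function.comp_apply] at hfub
  rw [← hT.lintegral_ratioProd (f := thinnedLaplace p δ θ) (by positivity)
    (antitoneOn_thinnedLaplace hp0 (by linarith) hθ)
    (fun x hx => (thinnedLaplace_mem_Icc hp0 hp1 hθ hx).1)
    (fun x hx => (thinnedLaplace_mem_Icc hp0 hp1 hθ hx).2)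
    (sum_one_sub_thinnedLaplace_le hp0 hp1 hδ hθ)
    (exists_le_sum_one_sub_thinnedLaplace hp0 hp1 hδ hθ), hfub]
  refine lintegral_congr fun ω' => ?_
  have ha : ∀ i, 0 ≤ θ * (T (argmin fun i => T i ω') ω' / T i ω') ^ δ := fun i =>
    mul_nonneg hθ (Real.rpow_nonneg (div_nonneg (hT.nonneg _ _) (hT.nonneg _ _)) _)
  refine le_antisymm ?_ ?_
  · exact le_iInf₂ fun s hs => lintegral_expNeg_weightedSum_le hv hvind ha hs
  · exact le_lintegral_expNeg_weightedSum hv hvind ha fun s hs => iInf₂_le s hs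

/-- `P(I = 0) ≤ E e^{-θ I}` for every `θ ≥ 0`, and the right side tends to `0` as `θ → ∞` because `p
> 0` and `G` is unbounded. -/
theorem ae_scaledInterf_ne_zero (hT : IsUnitPoisson μ T)
    (hv : ∀ i, IsThinnedExp μ p (v i)) (hvind : iIndepFun v μ)
    (hTv : IndepFun (fun ω i => T i ω) (fun ω i => v i ω) μ)
    (hp0 : 0 < p) (hp1 : p ≤ 1) (hδ : 1 < δ) :
    ∀ᵐ ω ∂μ, scaledInterf δ 1 (fun i => T i ω) (fun i => v i ω) ≠ 0 := by
  have hm := measurable_scaledInterf_comp hT hv δ 1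
  have h0 : MeasurableSet {ω | scaledInterf δ 1 (fun i => T i ω) (fun i => v i ω) = 0} :=
    hm (measurableSet_singleton 0)
  have hle : ∀ᶠ θ : ℝ in atTop,
      μ {ω | scaledInterf δ 1 (fun i => T i ω) (fun i => v i ω) = 0} ≤
        ENNReal.ofReal (1 / (1 + p * interfExponent δ θ)) := by
    filter_upwards [eventually_ge_atTop 0] with θ hθ
    rw [← lintegral_expNeg_scaledInterf hT hv hvind hTv hp0.le hp1 hδ hθ,
      ← lintegral_indicator_one h0]
    refine lintegral_mono fun ω => ?_
    by_cases h : scaledInterf δ 1 (fun i => T i ω) (fun i => v i ω) = 0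
    · rw [scaledInterf_eq_mul hθ, h]; simp [h]
    · simp [h]
  have hlim : Tendsto (fun θ : ℝ => ENNReal.ofReal (1 / (1 + p * interfExponent δ θ))) atTop
      (𝓝 0) := by
    rw [← ENNReal.ofReal_zero]
    refine ENNReal.tendsto_ofReal (Tendsto.div_atTop tendsto_const_nhds ?_)
    exact tendsto_atTop_add_const_left _ 1
      ((tendsto_interfExponent_atTop hδ).const_mul_atTop hp0)
  have := ge_of_tendsto hlim hle
  rw [ae_iff]
  simpa using this

/-- `P(I < ∞) ≥ E e^{-θ I}` for every `θ > 0`, and the right side tends to `1` as `θ → 0` by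
continuity of `G` at `0`. -/
theorem ae_scaledInterf_ne_top (hT : IsUnitPoisson μ T)
    (hv : ∀ i, IsThinnedExp μ p (v i)) (hvind : iIndepFun v μ)
    (hTv : IndepFun (fun ω i => T i ω) (fun ω i => v i ω) μ)
    (hp0 : 0 ≤ p) (hp1 : p ≤ 1) (hδ : 1 < δ) :
    ∀ᵐ ω ∂μ, scaledInterf δ 1 (fun i => T i ω) (fun i => v i ω) ≠ ∞ := by
  have hm := measurable_scaledInterf_comp hT hv δ 1
  have h0 : MeasurableSet {ω | scaledInterf δ 1 (fun i => T i ω) (fun i => v i ω) ≠ ∞} :=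
    hm (measurableSet_singleton ∞).compl
  have hle : ∀ᶠ θ : ℝ in 𝓝[>] 0, ENNReal.ofReal (1 / (1 + p * interfExponent δ θ)) ≤
      μ {ω | scaledInterf δ 1 (fun i => T i ω) (fun i => v i ω) ≠ ∞} := by
    filter_upwards [self_mem_nhdsWithin] with θ hθ
    have hθ0 : 0 < θ := hθ
    rw [← lintegral_expNeg_scaledInterf hT hv hvind hTv hp0 hp1 hδ hθ0.le,
      ← lintegral_indicator_one h0]
    refine lintegral_mono fun ω => ?_
    by_cases h : scaledInterf δ 1 (fun i => T i ω) (fun i => v i ω) = ∞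
    · rw [scaledInterf_eq_mul hθ0.le, h, ENNReal.mul_top (by simpa using hθ0)]
      simp
    · rw [indicator_of_mem (by exact h)]
      exact expNeg_le_one _
  have hlim : Tendsto (fun θ : ℝ => ENNReal.ofReal (1 / (1 + p * interfExponent δ θ))) (𝓝[>] 0)
      (𝓝 1) := by
    have hc : ContinuousAt (interfExponent δ) 0 :=
      (continuousOn_interfExponent hδ).continuousAt (Ioi_mem_nhds (by norm_num))
    have h1 : Tendsto (interfExponent δ) (𝓝[>] 0) (𝓝 0) := by
      have := hc.tendsto.mono_left (nhdsWithin_le_nhds (s := Ioi 0))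
      rwa [interfExponent_zero] at this
    have h2 : Tendsto (fun θ : ℝ => 1 / (1 + p * interfExponent δ θ)) (𝓝[>] 0)
        (𝓝 (1 / (1 + p * 0))) :=
      tendsto_const_nhds.div ((h1.const_mul p).const_add 1) (by simp)
    have := ENNReal.tendsto_ofReal h2
    simpa using this
  have h1 : μ {ω | scaledInterf δ 1 (fun i => T i ω) (fun i => v i ω) ≠ ∞} = 1 :=
    le_antisymm prob_le_one (le_of_tendsto hlim hle)
  exact (mem_ae_iff_prob_eq_one h0).2 h1

/-- For frozen positions the probability lies between `p E e^{-I}` and the same plus `P(I = 0)`;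
averaged over positions, the extra term is zero. -/
theorem measure_scaledInterf_le (hT : IsUnitPoisson μ T)
    (hv : ∀ i, IsThinnedExp μ p (v i)) (hvind : iIndepFun v μ)
    (hTv : IndepFun (fun ω i => T i ω) (fun ω i => v i ω) μ)
    (hp0 : 0 < p) (hp1 : p ≤ 1) (hδ : 1 < δ) (hθ : 0 < θ) :
    μ {ω | scaledInterf δ θ (fun i => T i ω) (fun i => v i ω) ≤ v (argmin fun i => T i ω) ω} =
      ENNReal.ofReal (p / (1 + p * interfExponent δ θ)) := by
  have hvm : Measurable fun ω i => v i ω := measurable_pi_lambda _ fun i => (hv i).measurable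
  have hF := measurable_scaledInterf δ θ
  have hSm : MeasurableSet {z : (ℕ → ℝ) × (ℕ → ℝ≥0∞) |
      scaledInterf δ θ z.1 z.2 ≤ z.2 (argmin z.1)} :=
    measurableSet_le hF
      (measurable_eval_nat (measurable_argmin.comp measurable_fst) measurable_snd)
  have hZm : MeasurableSet {z : (ℕ → ℝ) × (ℕ → ℝ≥0∞) | scaledInterf δ θ z.1 z.2 = 0} :=
    hF (measurableSet_singleton 0)
  have hfub : ∀ S : Set ((ℕ → ℝ) × (ℕ → ℝ≥0∞)), MeasurableSet S →
      μ {ω | ((fun i => T i ω), (fun i => v i ω)) ∈ S} =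
        ∫⁻ ω', μ {ω | ((fun i => T i ω'), (fun i => v i ω)) ∈ S} ∂μ := by
    intro S hS
    have h := lintegral_indepFun_eq hT.measurable_pi hvm hTv
      (F := S.indicator 1) (measurable_one.indicator hS)
    have h1 : MeasurableSet {ω | ((fun i => T i ω), (fun i => v i ω)) ∈ S} :=
      (hT.measurable_pi.prodMk hvm) hS
    have h2 : ∀ ω', MeasurableSet {ω | ((fun i => T i ω'), (fun i => v i ω)) ∈ S} := fun ω' =>
      (measurable_const.prodMk hvm) hS
    rw [← lintegral_indicator_one h1]
    simp_rw [← fun ω' => lintegral_indicator_one (μ := μ) (h2 ω')]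
    exact h
  have hE := lintegral_expNeg_scaledInterf hT hv hvind hTv hp0.le hp1 hδ hθ.le
  have hEfub := lintegral_indepFun_eq hT.measurable_pi hvm hTv (measurable_expNeg.comp hF)
  simp only [Function.comp_apply] at hEfub
  have hinner : Measurable fun ω' => ∫⁻ ω, expNeg
      (scaledInterf δ θ (fun i => T i ω') (fun i => v i ω)) ∂μ := by
    have h1 : Measurable fun t : ℕ → ℝ => ∫⁻ y, expNeg (scaledInterf δ θ t y)
        ∂(μ.map fun ω i => v i ω) := (measurable_expNeg.comp hF).lintegral_prod_right'
    convert! h1.comp hT.measurable_pi using 1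
    funext ω'
    exact (lintegral_map ((measurable_expNeg.comp hF).comp measurable_prodMk_left) hvm).symm
  have hzero : μ {ω | scaledInterf δ θ (fun i => T i ω) (fun i => v i ω) = 0} = 0 := by
    have := ae_scaledInterf_ne_zero hT hv hvind hTv hp0 hp1 hδ
    rw [ae_iff] at this
    simp only [not_not] at this
    refine measure_mono_null (fun ω hω => ?_) this
    have hω' : scaledInterf δ θ (fun i => T i ω) (fun i => v i ω) = 0 := hω
    rw [scaledInterf_eq_mul hθ.le, mul_eq_zero] at hω'
    exact hω'.resolve_left (by simpa using hθ)
  have htarget : ENNReal.ofReal (p / (1 + p * interfExponent δ θ)) =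
      ENNReal.ofReal p * ∫⁻ ω, expNeg (scaledInterf δ θ (fun i => T i ω) (fun i => v i ω)) ∂μ := by
    rw [hE, ← ENNReal.ofReal_mul hp0.le, mul_one_div]
  have hS := hfub _ hSm
  have hZ := hfub _ hZm
  simp only [mem_ofPred_eq] at hS hZ
  rw [htarget, hEfub, ← lintegral_const_mul _ hinner]
  refine le_antisymm ?_ ?_
  · calc _ = _ := hS
      _ ≤ ∫⁻ ω', ENNReal.ofReal p * ∫⁻ ω, expNeg
            (scaledInterf δ θ (fun i => T i ω') (fun i => v i ω)) ∂μ +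
          μ {ω | scaledInterf δ θ (fun i => T i ω') (fun i => v i ω) = 0} ∂μ :=
        lintegral_mono fun ω' => measure_weightedSum_le hv hvind _ _
      _ = _ := by
        rw [lintegral_add_left (hinner.const_mul _), ← hZ, hzero, add_zero]
  · rw [hS]
    exact lintegral_mono fun ω' => le_measure_weightedSum hv hvind hp1 _ _

end Fubini

end EdgeCaching

namespace EdgeCaching

/-! ### Reduction of the network model -/

/-- The squared distance from the origin, in units of the mean area per point. -/
noncomputable def scaledSq (lam : ℝ) (z : Plane) : ℝ := Real.pi * lam * ‖z‖ ^ 2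

theorem measurable_scaledSq (lam : ℝ) : Measurable (scaledSq lam) := by
  unfold scaledSq; fun_prop

theorem scaledSq_nonneg {lam : ℝ} (hlam : 0 < lam) (z : Plane) : 0 ≤ scaledSq lam z := by
  unfold scaledSq; positivity

/-- The annulus of points whose scaled squared distance lies in `[jΔ, (j+1)Δ)`. -/
def annulus (lam Δ : ℝ) (j : ℕ) : Set Plane := {z | ⌊scaledSq lam z / Δ⌋₊ = j}

theorem measurableSet_annulus (lam Δ : ℝ) (j : ℕ) : MeasurableSet (annulus lam Δ j) :=
  (Nat.measurable_floor.comp ((measurable_scaledSq lam).div_const Δ)) (measurableSet_singleton j)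

section Annulus

variable {lam Δ : ℝ}

theorem scaledSq_lt_iff (hlam : 0 < lam) {c : ℝ} {z : Plane} :
    scaledSq lam z < c ↔ z ∈ Metric.ball (0 : Plane) (√(c / (Real.pi * lam))) := by
  have h : 0 < Real.pi * lam := by positivity
  rw [mem_ball_zero_iff, Real.lt_sqrt (norm_nonneg z), lt_div_iff₀ h, scaledSq, mul_comm]

theorem annulus_eq (hlam : 0 < lam) (hΔ : 0 < Δ) (j : ℕ) :
    annulus lam Δ j = Metric.ball (0 : Plane) (√((j + 1) * Δ / (Real.pi * lam))) \
      Metric.ball (0 : Plane) (√(j * Δ / (Real.pi * lam))) := by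
  ext z
  have h0 : 0 ≤ scaledSq lam z / Δ := div_nonneg (scaledSq_nonneg hlam z) hΔ.le
  rw [Set.mem_sdiff, ← scaledSq_lt_iff hlam, ← scaledSq_lt_iff hlam, not_lt, ← le_div_iff₀ hΔ,
    ← div_lt_iff₀ hΔ, and_comm]
  exact Nat.floor_eq_iff h0

theorem isBounded_annulus (hlam : 0 < lam) (hΔ : 0 < Δ) (j : ℕ) :
    Bornology.IsBounded (annulus lam Δ j) := by
  rw [annulus_eq hlam hΔ]
  exact Metric.isBounded_ball.subset sdiff_subset

theorem lam_mul_volume_annulus (hlam : 0 < lam) (hΔ : 0 < Δ) (j : ℕ) :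
    lam * volume.real (annulus lam Δ j) = Δ := by
  have hball : ∀ c : ℝ, 0 ≤ c →
      volume.real (Metric.ball (0 : Plane) (√(c / (Real.pi * lam)))) = c / lam := by
    intro c hc
    rw [measureReal_def, EuclideanSpace.volume_ball_fin_two, ENNReal.toReal_mul,
      ENNReal.toReal_pow, ENNReal.toReal_ofReal (Real.sqrt_nonneg _),
      Real.sq_sqrt (by positivity), ENNReal.toReal_ofReal Real.pi_pos.le]
    have := Real.pi_pos.ne'
    field_simp
  rw [annulus_eq hlam hΔ, measureReal_sdiff _ measurableSet_ball
    (Metric.isBounded_ball.measure_lt_top.ne), hball _ (by positivity), hball _ (by positivity)]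
  · field_simp; ring
  · refine Metric.ball_subset_ball (Real.sqrt_le_sqrt ?_)
    gcongr
    linarith

end Annulus

/-- Cells on the half-line pull back to disjoint annuli of area `Δ / lam`, independently of `j`. -/
theorem IsHPPP.isUnitPoisson {Ω : Type*} [MeasurableSpace Ω] {μ : Measure Ω}
    {x : ℕ → Ω → Plane} {lam : ℝ} (h : IsHPPP μ x lam) (hlam : 0 < lam) :
    IsUnitPoisson μ (fun i ω => scaledSq lam (x i ω)) := by
  refine ⟨fun i => (measurable_scaledSq lam).comp (h.measurable i),
    fun i ω => scaledSq_nonneg hlam _, ?_, ?_⟩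
  · intro Δ hΔ j k
    have := h.count_law (annulus lam Δ j) (measurableSet_annulus lam Δ j)
      (isBounded_annulus hlam hΔ j) k
    rwa [lam_mul_volume_annulus hlam hΔ] at this
  · intro Δ hΔ
    rw [iIndepFun_iff_finset]
    intro s
    obtain ⟨n, hn⟩ : ∃ n, ∀ j ∈ s, j < n :=
      ⟨s.sup id + 1, fun j hj => Nat.lt_succ_of_le (Finset.le_sup (f := id) hj)⟩
    have := h.count_indep n (fun j => annulus lam Δ j) (fun j => measurableSet_annulus lam Δ j)
      (fun j => isBounded_annulus hlam hΔ j) (fun j l hjl => by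
        refine Set.disjoint_left.2 fun z hz hz' => hjl (Fin.ext ?_)
        exact (show ⌊scaledSq lam z / Δ⌋₊ = j from hz).symm.trans hz')
    exact this.precomp (g := fun j : s => (⟨j, hn j j.2⟩ : Fin n)) fun a b hab =>
      Subtype.ext (by simpa using hab)

/-- The count in `{0}` is Poisson with mean zero. This keeps path loss away from the convention for
`0 ^ (-α)`. -/
theorem IsHPPP.ae_ne_zero {Ω : Type*} [MeasurableSpace Ω] {μ : Measure Ω}
    [IsProbabilityMeasure μ] {x : ℕ → Ω → Plane} {lam : ℝ} (h : IsHPPP μ x lam) :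
    ∀ᵐ ω ∂μ, ∀ i, x i ω ≠ 0 := by
  have h1 := h.count_law {0} (measurableSet_singleton 0) Bornology.isBounded_singleton 0
  have h2 : {ω | pointCount (fun i => x i ω) {0} = ((0 : ℕ) : ℕ∞)} = {ω | ∀ i, x i ω ≠ 0} := by
    ext ω
    simp only [pointCount, Nat.cast_zero, Set.encard_eq_zero, mem_ofPred_eq,
      eq_empty_iff_forall_notMem, mem_singleton_iff, ne_eq]
  rw [h2, poissonMeasure_singleton] at h1
  have hm : MeasurableSet {ω | ∀ i, x i ω ≠ 0} := by
    have : {ω | ∀ i, x i ω ≠ 0} = ⋂ i, (x i ⁻¹' {0})ᶜ := by ext; simp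
    rw [this]
    exact MeasurableSet.iInter fun i => (h.measurable i (measurableSet_singleton 0)).compl
  refine (mem_ae_iff_prob_eq_one hm).2 ?_
  rw [h1]
  simp [measureReal_def]

theorem measurableSet_mem_pair (J : ℕ) : MeasurableSet {m : Fin J × Set (Fin J) | m.1 ∈ m.2} :=
  (Set.toFinite _).measurableSet

open Classical in
/-- The mark of an SBS: its channel gain if it has a hit, and `0` otherwise. -/
noncomputable def hitGain {J : ℕ} (m : ℝ × Fin J × Set (Fin J)) : ℝ≥0∞ :=
  if m.2.1 ∈ m.2.2 then ENNReal.ofReal m.1 else 0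

theorem measurable_hitGain (J : ℕ) : Measurable (hitGain (J := J)) :=
  Measurable.ite (measurable_snd (measurableSet_mem_pair J)) measurable_fst.ennreal_ofReal
    measurable_const

theorem expMeasure_one_neg : expMeasure 1 (Iio 0) = 0 := by
  rw [expMeasure, gammaMeasure, withDensity_apply _ measurableSet_Iio]
  exact lintegral_gammaPDF_of_nonpos le_rfl

/-! ### Hits, load and rate in the network -/

section Model

variable {Ω : Type*} [MeasurableSpace Ω] {μ : Measure Ω} {J : ℕ} {N : Network Ω J}
  {lamU lamS s : ℝ} {L : ℕ} {q : Fin J → ℝ}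

theorem Network.IsModel.measurableSet_hit (hmodel : N.IsModel μ lamU lamS s L q) (i : ℕ) :
    MeasurableSet {ω | N.Hit i ω} :=
  ((hmodel.request_meas i).prodMk (hmodel.cache_meas i)) (measurableSet_mem_pair J)

theorem zipf_nonneg (J : ℕ) (s : ℝ) (j : Fin J) : 0 ≤ zipf J s j := by
  unfold zipf; positivity

theorem Network.IsModel.measure_hit (hmodel : N.IsModel μ lamU lamS s L q)
    (hq : ∀ j, 0 ≤ q j) (i : ℕ) :
    μ {ω | N.Hit i ω} = ENNReal.ofReal (hitProb s q) := by
  have hset : {ω | N.Hit i ω} =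
      ⋃ j : Fin J, N.request i ⁻¹' {j} ∩ N.cache i ⁻¹' {c | j ∈ c} := by
    ext ω; simp [Network.Hit]
  have hc : ∀ j : Fin J, MeasurableSet {c : Set (Fin J) | j ∈ c} := fun j =>
    (Set.toFinite _).measurableSet
  rw [hset, measure_iUnion]
  · rw [tsum_fintype, hitProb, ENNReal.ofReal_sum_of_nonneg
      (fun j _ => mul_nonneg (zipf_nonneg J s j) (hq j))]
    refine Finset.sum_congr rfl fun j _ => ?_
    rw [(hmodel.request_cache_indep i).measure_inter_preimage_eq_mul _ _
      (measurableSet_singleton j) (hc j), ENNReal.ofReal_mul (zipf_nonneg J s j),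
      ← hmodel.request_law i j, ← hmodel.cache_law i j]
    rfl
  · intro j l hjl
    refine Set.disjoint_left.2 fun ω h1 h2 => hjl ?_
    exact (show N.request i ω = j from h1.1).symm.trans h2.1
  · exact fun j => (hmodel.request_meas i (measurableSet_singleton j)).inter
      (hmodel.cache_meas i (hc j))

theorem hitProb_nonneg (hq : ∀ j, 0 ≤ q j) : 0 ≤ hitProb s q :=
  Finset.sum_nonneg fun j _ => mul_nonneg (zipf_nonneg J s j) (hq j)

theorem Network.IsModel.hitProb_le_one [IsProbabilityMeasure μ]
    (hmodel : N.IsModel μ lamU lamS s L q)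
    (hq : ∀ j, 0 ≤ q j) : hitProb s q ≤ 1 := by
  have : μ {ω | N.Hit 0 ω} ≤ 1 := prob_le_one
  rw [hmodel.measure_hit hq] at this
  exact ENNReal.ofReal_le_one.1 this

/-- The mark of SBS `i`. -/
noncomputable def Network.mark (N : Network Ω J) (i : ℕ) (ω : Ω) : ℝ≥0∞ :=
  hitGain (N.fading i ω, N.request i ω, N.cache i ω)

theorem Network.IsModel.isThinnedExp_mark [IsProbabilityMeasure μ]
    (hmodel : N.IsModel μ lamU lamS s L q)
    (hq : ∀ j, 0 ≤ q j) (i : ℕ) : IsThinnedExp μ (hitProb s q) (N.mark i) := by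
  classical
  have hm : Measurable ({m : Fin J × Set (Fin J) | m.1 ∈ m.2}.indicator fun _ => (1 : ℝ≥0∞)) :=
    measurable_const.indicator (measurableSet_mem_pair J)
  have := isThinnedExp_of_indep (hmodel.fading_meas i) (hmodel.fading_law i)
    (hmodel.measurableSet_hit i) (hmodel.measure_hit hq i) (hitProb_nonneg hq)
    ((hmodel.fading_indep i).comp measurable_id hm)
  convert! this using 2

theorem Network.IsModel.iIndepFun_mark (hmodel : N.IsModel μ lamU lamS s L q) :
    iIndepFun N.mark μ :=
  hmodel.marks_indep.comp (fun _ => hitGain) fun _ => measurable_hitGain J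

theorem Network.IsModel.indepFun_pos_mark (hmodel : N.IsModel μ lamU lamS s L q) :
    IndepFun (fun ω i => scaledSq lamS (N.pos i ω)) (fun ω i => N.mark i ω) μ := by
  have h1 : Measurable fun (z : ℕ → Plane) i => scaledSq lamS (z i) :=
    measurable_pi_lambda _ fun i => (measurable_scaledSq lamS).comp (measurable_pi_apply i)
  have h2 : Measurable fun (z : ℕ → ℝ × Fin J × Set (Fin J)) i => hitGain (z i) :=
    measurable_pi_lambda _ fun i => (measurable_hitGain J).comp (measurable_pi_apply i)
  exact hmodel.pos_marks_indep.comp h1 h2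

theorem Network.server_eq_argmin {Ω : Type*} {N : Network Ω J} (hS : 0 < lamS) (ω : Ω) :
    N.server ω = argmin fun i => scaledSq lamS (N.pos i ω) := by
  unfold Network.server argmin
  congr 1
  ext n
  refine forall_congr' fun i => ?_
  have h : 0 < Real.pi * lamS := by positivity
  change ‖N.pos n ω‖ ≤ ‖N.pos i ω‖ ↔ scaledSq lamS (N.pos n ω) ≤ scaledSq lamS (N.pos i ω)
  rw [scaledSq, scaledSq, mul_le_mul_iff_right₀ h, sq_le_sq₀ (norm_nonneg _) (norm_nonneg _)]

/-- The random index of the server depends on the positions alone, which are independent of the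
marks, so it may be frozen. -/
theorem Network.IsModel.measure_cached [IsProbabilityMeasure μ]
    (hmodel : N.IsModel μ lamU lamS s L q)
    (hq : ∀ j, 0 ≤ q j) (hS : 0 < lamS) : μ N.cached = ENNReal.ofReal (hitProb s q) := by
  have hT := hmodel.pos_hppp.isUnitPoisson hS
  set HS : Set ((ℕ → ℝ) × (ℕ → ℝ × Fin J × Set (Fin J))) :=
    {z | (z.2 (argmin z.1)).2.1 ∈ (z.2 (argmin z.1)).2.2} with hHS
  have hHSm : MeasurableSet HS :=
    (measurable_snd.comp (measurable_eval_nat (measurable_argmin.comp measurable_fst)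
      measurable_snd)) (measurableSet_mem_pair J)
  have hMm : Measurable fun ω i => (N.fading i ω, N.request i ω, N.cache i ω) :=
    measurable_pi_lambda _ fun i => (hmodel.fading_meas i).prodMk
      ((hmodel.request_meas i).prodMk (hmodel.cache_meas i))
  have h1 : Measurable fun (z : ℕ → Plane) i => scaledSq lamS (z i) :=
    measurable_pi_lambda _ fun i => (measurable_scaledSq lamS).comp (measurable_pi_apply i)
  have hfub := lintegral_indepFun_eq hT.measurable_pi hMm
    (hmodel.pos_marks_indep.comp h1 measurable_id) (F := HS.indicator 1)
    (measurable_one.indicator hHSm)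
  have hc : N.cached = {ω | ((fun i => scaledSq lamS (N.pos i ω)),
      (fun i => (N.fading i ω, N.request i ω, N.cache i ω))) ∈ HS} := by
    ext ω
    simp only [Network.cached, Network.Hit, hHS, mem_ofPred_eq,
      Network.server_eq_argmin (N := N) hS]
  have hcm : MeasurableSet N.cached := by
    rw [hc]; exact (hT.measurable_pi.prodMk hMm) hHSm
  rw [← lintegral_indicator_one hcm]
  calc ∫⁻ ω, N.cached.indicator 1 ω ∂μ = _ := by
        refine lintegral_congr fun ω => ?_
        rw [hc]; rfl
    _ = _ := hfub
    _ = ∫⁻ _, ENNReal.ofReal (hitProb s q) ∂μ := by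
        refine lintegral_congr fun ω' => ?_
        rw [← hmodel.measure_hit hq (argmin fun i => scaledSq lamS (N.pos i ω')),
          ← lintegral_indicator_one (hmodel.measurableSet_hit _)]
        rfl
    _ = _ := by simp

/-- The event that the relative interference is at most `1 / θ` times the mark of the server. -/
def Network.sirEvent (N : Network Ω J) (lamS δ θ : ℝ) : Set Ω :=
  {ω | scaledInterf δ θ (fun i => scaledSq lamS (N.pos i ω)) (fun i => N.mark i ω) ≤
    N.mark (argmin fun i => scaledSq lamS (N.pos i ω)) ω}

theorem Network.IsModel.measure_sirEvent [IsProbabilityMeasure μ]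
    (hmodel : N.IsModel μ lamU lamS s L q)
    (hq : ∀ j, 0 ≤ q j) (hS : 0 < lamS) (hhit : 0 < hitProb s q) {δ θ : ℝ} (hδ : 1 < δ)
    (hθ : 0 < θ) :
    μ (N.sirEvent lamS δ θ) =
      ENNReal.ofReal (hitProb s q / (1 + hitProb s q * interfExponent δ θ)) :=
  measure_scaledInterf_le (hmodel.pos_hppp.isUnitPoisson hS) (hmodel.isThinnedExp_mark hq)
    hmodel.iIndepFun_mark hmodel.indepFun_pos_mark hhit (hmodel.hitProb_le_one hq) hδ hθ

/-- Both events are functions of positions and marks, of which the load is independent. A general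
`K` serves both single loads and the range up to the maximum load. -/
theorem Network.IsModel.measurableSet_cached_and_indep (hmodel : N.IsModel μ lamU lamS s L q)
    (hS : 0 < lamS) (δ θ : ℝ) (K : Set ℕ) :
    MeasurableSet N.cached ∧ MeasurableSet {ω | N.load ω ∈ K} ∧
      μ (N.cached ∩ {ω | N.load ω ∈ K}) = μ N.cached * μ {ω | N.load ω ∈ K} ∧
      μ (N.sirEvent lamS δ θ ∩ {ω | N.load ω ∈ K}) =
        μ (N.sirEvent lamS δ θ) * μ {ω | N.load ω ∈ K} := by
  have hT : Measurable fun (z : ℕ → Plane × ℝ × Fin J × Set (Fin J)) i => scaledSq lamS (z i).1 :=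
    measurable_pi_lambda _ fun i => (measurable_scaledSq lamS).comp
      (measurable_fst.comp (measurable_pi_apply i))
  have hv : Measurable fun (z : ℕ → Plane × ℝ × Fin J × Set (Fin J)) i => hitGain (z i).2 :=
    measurable_pi_lambda _ fun i => (measurable_hitGain J).comp
      (measurable_snd.comp (measurable_pi_apply i))
  have hn : Measurable fun z : ℕ → Plane × ℝ × Fin J × Set (Fin J) =>
      argmin fun i => scaledSq lamS (z i).1 := measurable_argmin.comp hT
  have hC : MeasurableSet {z : ℕ → Plane × ℝ × Fin J × Set (Fin J) |
      (z (argmin fun i => scaledSq lamS (z i).1)).2.2.1 ∈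
        (z (argmin fun i => scaledSq lamS (z i).1)).2.2.2} :=
    (measurable_snd.comp (measurable_snd.comp (measurable_eval_nat hn measurable_id)))
      (measurableSet_mem_pair J)
  have hE : MeasurableSet {z : ℕ → Plane × ℝ × Fin J × Set (Fin J) |
      scaledInterf δ θ (fun i => scaledSq lamS (z i).1) (fun i => hitGain (z i).2) ≤
        hitGain (z (argmin fun i => scaledSq lamS (z i).1)).2} :=
    measurableSet_le ((measurable_scaledInterf δ θ).comp (hT.prodMk hv))
      (measurable_eval_nat hn hv)
  have hZ : Measurable fun ω i => (N.pos i ω, N.fading i ω, N.request i ω, N.cache i ω) :=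
    measurable_pi_lambda _ fun i => (hmodel.pos_hppp.measurable i).prodMk
      ((hmodel.fading_meas i).prodMk ((hmodel.request_meas i).prodMk (hmodel.cache_meas i)))
  have hK : MeasurableSet {p : ℝ × ℕ | p.2 + 1 ∈ K} :=
    (measurable_snd.add_const 1) (MeasurableSet.of_discrete (s := K))
  have hc : N.cached = (fun ω i => (N.pos i ω, N.fading i ω, N.request i ω, N.cache i ω)) ⁻¹'
      {z | (z (argmin fun i => scaledSq lamS (z i).1)).2.2.1 ∈
        (z (argmin fun i => scaledSq lamS (z i).1)).2.2.2} := by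
    ext ω
    simp only [Network.cached, Network.Hit, mem_ofPred_eq, mem_preimage,
      Network.server_eq_argmin (N := N) hS]
  have hind := hmodel.load_indep.symm
  refine ⟨hc ▸ hZ hC, (hmodel.area_meas.prodMk hmodel.others_meas) hK, ?_, ?_⟩
  · rw [hc]
    exact hind.measure_inter_preimage_eq_mul _ _ hC hK
  · exact hind.measure_inter_preimage_eq_mul _ _ hE hK

theorem Network.IsModel.ae_fading_nonneg (hmodel : N.IsModel μ lamU lamS s L q) :
    ∀ᵐ ω ∂μ, ∀ i, 0 ≤ N.fading i ω := by
  rw [ae_all_iff]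
  intro i
  have h := expMeasure_one_neg
  rw [← hmodel.fading_law i, Measure.map_apply (hmodel.fading_meas i) measurableSet_Iio] at h
  rw [ae_iff]
  simpa [Set.preimage] using h

theorem Network.interference_eq {Ω : Type*} {N : Network Ω J} (A : Access) (hP : 0 < A.P) (hβ : 0 < A.β) (hS : 0 < lamS)
    {ω : Ω} (hpos : ∀ i, N.pos i ω ≠ 0) (hfad : ∀ i, 0 ≤ N.fading i ω) :
    N.interference A ω = A.P * A.pathLoss ‖N.pos (N.server ω) ω‖ *
      (scaledInterf (A.α / 2) 1 (fun i => scaledSq lamS (N.pos i ω))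
        (fun i => N.mark i ω)).toReal := by
  classical
  have hr : ∀ i, 0 < ‖N.pos i ω‖ := fun i => norm_pos_iff.2 (hpos i)
  rw [scaledInterf, weightedSum, ENNReal.tsum_toReal_eq, ← tsum_mul_left, Network.interference]
  · refine tsum_congr fun i => ?_
    rw [← Network.server_eq_argmin (N := N) hS]
    by_cases hi : i = N.server ω
    · simp [hi]
    · rw [if_neg hi, Network.mark, hitGain]
      by_cases hh : N.Hit i ω
      · rw [if_pos ⟨hi, hh⟩, if_pos (show N.request i ω ∈ N.cache i ω from hh),
          ENNReal.toReal_mul, ENNReal.toReal_ofReal (hfad i), one_mul, ENNReal.toReal_ofReal]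
        · have h1 : scaledSq lamS (N.pos (N.server ω) ω) / scaledSq lamS (N.pos i ω) =
              (‖N.pos (N.server ω) ω‖ / ‖N.pos i ω‖) ^ (2 : ℝ) := by
            have := (hr i).ne'
            have := Real.pi_pos.ne'
            rw [scaledSq, scaledSq, Real.rpow_two]
            field_simp
          rw [h1, ← Real.rpow_mul (by positivity), mul_div_cancel₀ _ two_ne_zero,
            Real.div_rpow (norm_nonneg _) (norm_nonneg _), Access.pathLoss, Access.pathLoss,
            Real.rpow_neg (norm_nonneg _), Real.rpow_neg (norm_nonneg _)]
          have h2 := Real.rpow_pos_of_pos (hr i) A.α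
          have h3 := Real.rpow_pos_of_pos (hr (N.server ω)) A.α
          field_simp
        · exact Real.rpow_nonneg (div_nonneg (scaledSq_nonneg hS _) (scaledSq_nonneg hS _)) _
      · rw [if_neg (fun h => hh h.2), if_neg (show ¬ N.request i ω ∈ N.cache i ω from hh)]
        simp
  · intro i
    split_ifs
    · simp
    · refine ENNReal.mul_ne_top ENNReal.ofReal_ne_top ?_
      rw [Network.mark, hitGain]
      split_ifs <;> simp

theorem le_rate_iff {η W T Q k h y : ℝ} (hη : 0 < η) (hW : 0 < W) (hT : 0 < T) (hk : 0 < k)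
    (hh : 0 ≤ h) (hy : 0 < y) :
    Q / T ≤ η * W / k * Real.logb 2 (1 + h / y) ↔
      ((2 : ℝ) ^ (k * Q / (η * W * T)) - 1) * y ≤ h := by
  have h1 : 0 < 1 + h / y := by positivity
  rw [div_mul_eq_mul_div, le_div_iff₀ hk, ← div_le_iff₀' (by positivity),
    Real.le_logb_iff_rpow_le one_lt_two h1, ← le_div_iff₀ hy, sub_le_iff_le_add']
  have : Q / T * k / (η * W) = k * Q / (η * W * T) := by field_simp
  rw [this]

/-- The hit need not be listed on the right: without it the mark of the server is `0`, which cannot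
dominate a positive interference. Almost sure positivity and finiteness of the interference also
rule out the conventions `x / 0 = 0` and `∞.toReal = 0` in the rate. -/
theorem Network.IsModel.cached_inter_rate_ae_eq [IsProbabilityMeasure μ]
    (hmodel : N.IsModel μ lamU lamS s L q)
    (hq : ∀ j, 0 ≤ q j) (hS : 0 < lamS) (hhit : 0 < hitProb s q) {A : Access} {Q T : ℝ}
    (hη : 0 < A.η) (hW : 0 < A.W) (hP : 0 < A.P) (hβ : 0 < A.β) (hα : 2 < A.α)
    (hnoise : A.noise = 0) (hQ : 0 < Q) (hT : 0 < T) {k : ℕ} (hk : 1 ≤ k) :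
    (N.cached ∩ {ω | N.load ω ∈ ({k} : Set ℕ)} ∩ {ω | Q / T ≤ N.rate A ω} : Set Ω) =ᵐ[μ]
      (N.sirEvent lamS (A.α / 2) (sirThreshold A Q T k) ∩ {ω | N.load ω ∈ ({k} : Set ℕ)} :
        Set Ω) := by
  have hδ : 1 < A.α / 2 := by linarith
  have hk0 : (0 : ℝ) < k := by exact_mod_cast hk
  have hθ : 0 < sirThreshold A Q T k := by
    have := strictMono_sirThreshold hη hW hQ hT hk0
    rwa [sirThreshold_zero] at this
  have hU := hmodel.pos_hppp.isUnitPoisson hS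
  filter_upwards [hmodel.ae_fading_nonneg, hmodel.pos_hppp.ae_ne_zero,
    ae_scaledInterf_ne_zero hU (hmodel.isThinnedExp_mark hq) hmodel.iIndepFun_mark
      hmodel.indepFun_pos_mark hhit (hmodel.hitProb_le_one hq) hδ,
    ae_scaledInterf_ne_top hU (hmodel.isThinnedExp_mark hq) hmodel.iIndepFun_mark
      hmodel.indepFun_pos_mark hhit.le (hmodel.hitProb_le_one hq) hδ] with ω hfad hpos h0 htop
  refine propext ?_
  change ((N.Hit (N.server ω) ω ∧ N.load ω = k) ∧ Q / T ≤ N.rate A ω) ↔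
    (scaledInterf (A.α / 2) (sirThreshold A Q T k) (fun i => scaledSq lamS (N.pos i ω))
      (fun i => N.mark i ω) ≤ N.mark (argmin fun i => scaledSq lamS (N.pos i ω)) ω ∧
      N.load ω = k)
  rw [and_right_comm, and_congr_left_iff]
  intro hload
  rw [scaledInterf_eq_mul hθ.le, ← Network.server_eq_argmin (N := N) hS, Network.rate, hload,
    Network.interference_eq A hP hβ hS hpos hfad, hnoise, add_zero]
  set y := scaledInterf (A.α / 2) 1 (fun i => scaledSq lamS (N.pos i ω)) (fun i => N.mark i ω)
  have hy : 0 < y.toReal := ENNReal.toReal_pos h0 htop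
  have hpl : 0 < A.pathLoss ‖N.pos (N.server ω) ω‖ :=
    mul_pos hβ (Real.rpow_pos_of_pos (norm_pos_iff.2 (hpos _)) _)
  have hsir : A.P * N.fading (N.server ω) ω * A.pathLoss ‖N.pos (N.server ω) ω‖ /
      (A.P * A.pathLoss ‖N.pos (N.server ω) ω‖ * y.toReal) =
      N.fading (N.server ω) ω / y.toReal := by field_simp
  rw [hsir, le_rate_iff hη hW hT hk0 (hfad _) hy, Network.mark, hitGain]
  by_cases hh : N.Hit (N.server ω) ω
  · rw [if_pos (show N.request _ ω ∈ N.cache _ ω from hh), ← ENNReal.ofReal_toReal htop,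
      ← ENNReal.ofReal_mul hθ.le, ENNReal.ofReal_le_ofReal_iff (hfad _),
      ENNReal.toReal_ofReal hy.le]
    exact and_iff_right hh
  · rw [if_neg (show ¬ N.request _ ω ∈ N.cache _ ω from hh)]
    refine iff_of_false (fun h => hh h.1) fun h => ?_
    rcases mul_eq_zero.1 (nonpos_iff_eq_zero.1 h) with h | h
    · exact hθ.not_ge (ENNReal.ofReal_eq_zero.1 h)
    · exact h0 h

theorem Network.IsModel.condSuccess_eq [IsProbabilityMeasure μ]
    (hmodel : N.IsModel μ lamU lamS s L q)
    (hq : ∀ j, 0 ≤ q j) (hU : 0 < lamU) (hS : 0 < lamS) (hhit : 0 < hitProb s q) {A : Access}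
    {Q T : ℝ} (hη : 0 < A.η) (hW : 0 < A.W) (hP : 0 < A.P) (hβ : 0 < A.β) (hα : 2 < A.α)
    (hnoise : A.noise = 0) (hQ : 0 < Q) (hT : 0 < T) {k : ℕ} (hk : 1 ≤ k) :
    N.condSuccess μ A Q T k = 1 / (1 + hitProb s q * loadFun A Q T k) := by
  have hk0 : (0 : ℝ) < k := by exact_mod_cast hk
  have hθ : 0 < sirThreshold A Q T k := by
    have := strictMono_sirThreshold hη hW hQ hT hk0
    rwa [sirThreshold_zero] at this
  obtain ⟨hCm, hKm, hCK, hEK⟩ := hmodel.measurableSet_cached_and_indep hS (A.α / 2)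
    (sirThreshold A Q T k) {k}
  have hG := interfExponent_nonneg (δ := A.α / 2) hθ.le
  have hload : μ.real {ω | N.load ω ∈ ({k} : Set ℕ)} = loadPMF (lamU / lamS) k :=
    hmodel.load_real hU hS hk
  have hpmf : 0 < loadPMF (lamU / lamS) k := loadPMF_pos (by positivity)
  change (μ[|N.cached ∩ {ω | N.load ω ∈ ({k} : Set ℕ)}]).real {ω | Q / T ≤ N.rate A ω} = _
  rw [measureReal_def, cond_apply (hCm.inter hKm),
    measure_congr (hmodel.cached_inter_rate_ae_eq hq hS hhit hη hW hP hβ hα hnoise hQ hT hk),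
    hCK, hEK, hmodel.measure_cached hq hS,
    hmodel.measure_sirEvent hq hS hhit (by linarith) hθ, ENNReal.toReal_mul, ENNReal.toReal_inv,
    ENNReal.toReal_mul, ENNReal.toReal_mul, ENNReal.toReal_ofReal hhit.le,
    ENNReal.toReal_ofReal (by positivity), ← measureReal_def, hload, loadFun_eq_interfExponent hα]
  field_simp

theorem Network.IsModel.cond_load [IsProbabilityMeasure μ]
    (hmodel : N.IsModel μ lamU lamS s L q)
    (hq : ∀ j, 0 ≤ q j) (hS : 0 < lamS) (hhit : 0 < hitProb s q) (K : Set ℕ) :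
    (μ[|N.cached]).real {ω | N.load ω ∈ K} = μ.real {ω | N.load ω ∈ K} := by
  -- The values `1 1` are placeholders: the clause that involves them is discarded.
  obtain ⟨hCm, hKm, hCK, -⟩ := hmodel.measurableSet_cached_and_indep hS 1 1 K
  have h0 : μ N.cached ≠ 0 := by
    rw [hmodel.measure_cached hq hS]; simpa using hhit
  rw [measureReal_def, cond_apply hCm, hCK, ← mul_assoc,
    ENNReal.inv_mul_cancel h0 (measure_ne_top _ _), one_mul, measureReal_def]

theorem Network.IsModel.load_mem_Icc [IsProbabilityMeasure μ]
    (hmodel : N.IsModel μ lamU lamS s L q) (hU : 0 < lamU)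
    (hS : 0 < lamS) (n : ℕ) :
    μ.real {ω | N.load ω ∈ Icc 1 n} = ∑ k ∈ Finset.Icc 1 n, loadPMF (lamU / lamS) k := by
  have hm : Measurable N.load := hmodel.others_meas.add_const 1
  have hset : {ω | N.load ω ∈ Icc 1 n} = ⋃ k ∈ Finset.Icc 1 n, N.load ⁻¹' {k} := by
    ext ω; simp
  rw [hset, measureReal_biUnion_finset]
  · exact Finset.sum_congr rfl fun k hk => hmodel.load_real hU hS (Finset.mem_Icc.1 hk).1
  · intro k _ l _ hkl
    exact Disjoint.preimage _ (Set.disjoint_singleton.2 hkl)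
  · exact fun k _ => hm (measurableSet_singleton k)

end Model

end EdgeCaching

/-! ### The theorem on the maximum load -/

theorem theorem1 {Ω : Type*} [MeasurableSpace Ω] (μ : Measure Ω) [IsProbabilityMeasure μ]
    {J : ℕ} (N : EdgeCaching.Network Ω J) (A : EdgeCaching.Access)
    (lamU lamS s Q T ε : ℝ) (L : ℕ) (q : Fin J → ℝ)
    (hlamU : 0 < lamU) (hlamS : 0 < lamS) (hq : ∀ j, 0 ≤ q j ∧ q j ≤ 1)
    (hmodel : N.IsModel μ lamU lamS s L q)
    (hhit : 0 < EdgeCaching.hitProb s q)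
    (hη : 0 < A.η) (hη1 : A.η ≤ 1) (hW : 0 < A.W) (hP : 0 < A.P) (hβ : 0 < A.β)
    (hα : 2 < A.α) (hnoise : A.noise = 0)
    (hQ : 0 < Q) (hT : 0 < T) (hε : 0 < ε) (hε1 : ε ≤ 1) :
    -- the law of the cell load
    (∀ k : ℕ, 1 ≤ k → μ.real {ω | N.load ω = k} = EdgeCaching.loadPMF (lamU / lamS) k) ∧
    ∃ κ : ℝ, 0 ≤ κ ∧
      -- `κ` is the unique real solution of the equation for the maximum load
      (∀ t : ℝ, EdgeCaching.loadFun A Q T t = (1 - ε) / (EdgeCaching.hitProb s q * ε) ↔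
        t = κ) ∧
      -- its integer part is the maximum load with conditional success probability `≥ ε`
      (∀ k : ℕ, 1 ≤ k → (ε ≤ N.condSuccess μ A Q T k ↔ k ≤ ⌊κ⌋₊)) ∧
      -- the successful content delivery probability
      N.scdProb μ A Q T ε =
        ∑ k ∈ Finset.Icc 1 ⌊κ⌋₊, EdgeCaching.loadPMF (lamU / lamS) k ∧
      -- the one-dimensional search converges to `κ` and halves the error in every step
      (∀ l h : ℝ, l ≤ κ → κ ≤ h → ∀ n : ℕ, ∀ p : ℝ × ℝ,
        p = (EdgeCaching.searchStep (EdgeCaching.loadFun A Q T)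
          ((1 - ε) / (EdgeCaching.hitProb s q * ε)))^[n] (l, h) →
        p.1 ≤ κ ∧ κ ≤ p.2 ∧ p.2 - p.1 ≤ (h - l) / 2 ^ n) := by
  have hq0 : ∀ j, 0 ≤ q j := fun j => (hq j).1
  have hmono := EdgeCaching.strictMono_loadFun (A := A) (Q := Q) (T := T) hα hη hW hQ hT
  obtain ⟨κ, hκ0, hκ⟩ := EdgeCaching.exists_loadFun_eq (A := A) (Q := Q) (T := T) hα hη hW hQ hT
    (c := (1 - ε) / (EdgeCaching.hitProb s q * ε))
    (div_nonneg (by linarith) (by positivity))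
  have hmax : ∀ k : ℕ, 1 ≤ k → (ε ≤ N.condSuccess μ A Q T k ↔ k ≤ ⌊κ⌋₊) := by
    intro k hk
    have hF0 : 0 ≤ EdgeCaching.loadFun A Q T k := by
      rw [EdgeCaching.loadFun_eq_interfExponent hα]
      refine EdgeCaching.interfExponent_nonneg ?_
      have := (EdgeCaching.strictMono_sirThreshold hη hW hQ hT).monotone
        (Nat.cast_nonneg k : (0 : ℝ) ≤ k)
      rwa [EdgeCaching.sirThreshold_zero] at this
    -- `ε ≤ 1 / (1 + p F(k))` rearranges to `F(k) ≤ (1 - ε) / (p ε) = F(κ)`, and `F` is strictly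
    -- increasing.
    rw [hmodel.condSuccess_eq hq0 hlamU hlamS hhit hη hW hP hβ hα hnoise hQ hT hk,
      Nat.le_floor_iff hκ0, ← hmono.le_iff_le (b := κ), hκ, le_div_iff₀ (by positivity),
      le_div_iff₀ (by positivity)]
    constructor <;> intro h <;> linarith
  refine ⟨fun k hk => hmodel.load_real hlamU hlamS hk, κ, hκ0, fun t => ?_, hmax, ?_, ?_⟩
  · rw [← hκ]
    exact hmono.injective.eq_iff
  · have hset : {ω | ε ≤ N.condSuccess μ A Q T (N.load ω)} = {ω | N.load ω ∈ Icc 1 ⌊κ⌋₊} := by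
      ext ω
      -- The load counts the typical user, so the criterion for `k ≥ 1` applies at every `ω`.
      have h1 : 1 ≤ N.load ω := Nat.le_add_left _ _
      simp only [mem_ofPred_eq, mem_Icc, hmax _ h1, h1, true_and]
    rw [EdgeCaching.Network.scdProb, hset, hmodel.cond_load hq0 hlamS hhit,
      hmodel.load_mem_Icc hlamU hlamS]
  · intro l h hl hh n p hp
    rw [hp, ← hκ]
    exact EdgeCaching.searchStep_iterate hmono hl hh n
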